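/- Let $M$ be a compact metric space, $q\ge 1$, $d\ge 0$, and for $1\le i\le q$ let $T_i:M\to M$ preserve a Borel probability measure $\mu_i$ that is (strongly) mixing for $T_i$. Let $\phi_i:M\to[0,1)$ be Hölder continuous and positive $\mu_i$-a.e., with $\log\phi_i\in L^1(\mu_i)$ and $\int\log\phi_i\,d\mu_i<0$. Put $\mu=\mu_1\times\dots\times\mu_q$ on $M^q$. For $\mathbf x=(x_1,\dots,x_q)\in M^q$ let $c^{(k)}_i=\phi_i(T_i^k x_i)$ ($k\ge1$), and for a word $\omega=(i_1,\dots,i_k)\in D_k=\{1,\dots,q\}^k$ let $\Psi_\omega=\prod_{j=1}^k c^{(j)}_{i_j}=\prod_{j=1}^k\phi_{i_j}(T_{i_j}^jx_{i_j})$, with $\Psi_\emptyset=1$. Then the equation $$\int_{M^q}\log\Big(\sum_{i=1}^q\phi_i(x_i)^{s}\Big)\,d\mu(\mathbf x)=0$$ has a unique real solution $s_*$ (with integrable integrand), $s_*\ge0$, and for $\mu$-a.e. $\mathbf x$ the following holds. Let $\{\Delta_\omega\subset\mathbb R^d\}$, indexed by the finite words $\omega$, be any Moran construction, i.e. nonempty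 compact sets with $\Delta_{\omega*j}\subseteq\Delta_\omega$, $\max_{\omega\in D_k}\operatorname{diam}\Delta_\omega\to0$ as $k\to\infty$ and, with $F=\bigcap_k\bigcup_{\omega\in D_k}\Delta_\omega$, $\Delta_\omega\cap\Delta_{\omega'}\cap F=\emptyset$ for distinct words $\omega,\omega'$ of the same length. (For example $\Delta_\omega=f_{1,i_1}\circ\dots\circ f_{k,i_k}(\Delta)$ for contractions $f_{j,i}$.) Suppose that the vectors are basic, $\sup_{k,i}c^{(k)}_i<1$, and that: * (UE) there is $C>0$ with $\operatorname{diam}\Delta_\omega\le C\,\Psi_\omega$ for all $\omega$; * (LE) there is $N_0$ such that for all $x\in F$ and $0<r<1$ fewer than $N_0$ elements of the Moran covering of $F$ at scale $r$ meet the open ball $B(x,r)$. Here the Moran covering consists of the maximal sets $\Delta_\omega\cap F$ among those for which $\Psi_\omega>r$ and $\Psi_{\omega*j}\le r$ for some letter $j$; * (A3) for every $\beta>0$ there are a measure $m$ supported on $F$ and $L>0$ such that for all $k\ge1$ and $\omega\in D_k$ $$\frac{L^{-1}\,\Psi_\omega^\beta}{\sum_{\omega'\in D_k}\Psi_{\omega'}^\beta}\le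 m(\Delta_\omega)\le\frac{L\,\Psi_\omega^\beta}{\sum_{\omega'\in D_k}\Psi_{\omega'}^\beta}.$$ Then the Hausdorff, packing and upper box dimensions of $F$ all equal $s_*$: $$\dim_H F=\dim_P F=\overline{\dim}_B F=s_*.$$ -/

import Mathlib

open MeasureTheory Filter Topology Metric
open scoped NNReal ENNReal

noncomputable section

namespace Moran

/-! ### Fractal dimensions (the Hausdorff dimension is Mathlib's `dimH`) -/

section Dimensions

variable {X : Type*} [MetricSpace X]

/-- Upper box dimension: `limsup_{ε → 0⁺} log N(ε) / log (1/ε)`, where `N(ε)` is the smallest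
number of `ε`-balls (with arbitrary centres) needed to cover `F`. -/
def upperBoxDim (F : Set X) : EReal :=
  limsup (fun ε : ℝ≥0 =>
    ENNReal.log (ENat.toENNReal (externalCoveringNumber ε F)) /
      ((Real.log (1 / (ε : ℝ)) : ℝ) : EReal)) (𝓝[>] 0)

/-- `B` is a packing of `F` at scale `ε`: a collection of (centre, radius) pairs with centres
in `F`, radii in `(0, ε]`, and pairwise disjoint balls. -/
def IsPacking (ε : ℝ) (F : Set X) (B : Set (X × ℝ)) : Prop :=
  (∀ p ∈ B, p.1 ∈ F ∧ 0 < p.2 ∧ p.2 ≤ ε) ∧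
    B.PairwiseDisjoint (fun p => closedBall p.1 p.2)

/-- `𝒫^s_ε(F)`, the supremum of `∑ diam(B_i)^s` over packings of `F` at scale `ε`. -/
def packingSum (s ε : ℝ) (F : Set X) : ℝ≥0∞ :=
  ⨆ (B : Set (X × ℝ)) (_ : IsPacking ε F B),
    ∑' p : B, Metric.ediam (closedBall p.1.1 p.1.2) ^ s

/-- `𝒫^s_0(F) = lim_{ε → 0} 𝒫^s_ε(F)`, a decreasing limit. -/
def packingPremeasure (s : ℝ) (F : Set X) : ℝ≥0∞ :=
  ⨅ (ε : ℝ) (_ : 0 < ε), packingSum s ε F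

/-- The `s`-dimensional packing measure. -/
def packingMeasure (s : ℝ) (F : Set X) : ℝ≥0∞ :=
  ⨅ (G : ℕ → Set X) (_ : F ⊆ ⋃ i, G i), ∑' i, packingPremeasure s (G i)

/-- The packing dimension `sup {s ≥ 0 : 𝒫^s(F) = ∞}`. -/
def dimP (F : Set X) : ℝ≥0∞ :=
  ⨆ (s : ℝ≥0) (_ : packingMeasure (s : ℝ) F = ∞), (s : ℝ≥0∞)

end Dimensions

/-! ### Moran constructions over the words in `q` letters

A word of length `k` is a function `Fin k → Fin q`.  `Fin.init ω` is `ω` without its last letter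
and `Fin.snoc ω j` is `ω` followed by the letter `j`. -/

section Constructions

variable {q : ℕ} {X : Type*} [MetricSpace X]

/-- The first `l` letters of a word of length `k`. -/
def wordPrefix {k l : ℕ} (h : l ≤ k) (ω : Fin k → Fin q) : Fin l → Fin q :=
  fun j => ω (Fin.castLE h j)

/-- The limit set `F = ⋂_k ⋃_{|ω| = k} Δ_ω`. -/
def limitSet (Δ : ∀ k : ℕ, (Fin k → Fin q) → Set X) : Set X :=
  ⋂ k : ℕ, ⋃ ω : Fin k → Fin q, Δ k ω

/-- The basic sets `Δ_ω` form a (generalized) Moran construction: they are nonempty compact sets,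
nested, with diameters tending to zero uniformly in the length of the word, and weakly separated:
two distinct words of the same length have basic sets that do not meet inside the limit set.
How the basic sets are produced (e.g. as images `f_ω(Δ)` under compositions of contractions)
is left free. -/
structure IsMoranConstruction (Δ : ∀ k : ℕ, (Fin k → Fin q) → Set X) : Prop where
  isCompact : ∀ k ω, IsCompact (Δ k ω)
  nonempty : ∀ k ω, (Δ k ω).Nonempty
  nested : ∀ k (ω : Fin (k + 1) → Fin q), Δ (k + 1) ω ⊆ Δ k (Fin.init ω)
  tendsto_diam : Tendsto (fun k => ⨆ ω : Fin k → Fin q, Metric.diam (Δ k ω)) atTop (𝓝 0)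
  separated : ∀ k (ω ω' : Fin k → Fin q), ω ≠ ω' → Δ k ω ∩ Δ k ω' ∩ limitSet Δ = ∅

/-- `Ψ_ω = ∏_j c^{(j)}_{i_j}` for `ω = (i_1, …, i_k)`; here `c j i` is the contraction number
of the letter `i` at step `j + 1`. -/
def weight (c : ℕ → Fin q → ℝ) {k : ℕ} (ω : Fin k → Fin q) : ℝ :=
  ∏ j : Fin k, c j (ω j)

/-- Basic collection of vectors: `sup_{k,j} c^{(k)}_j < 1`. -/
def IsBasic (c : ℕ → Fin q → ℝ) : Prop :=
  ∃ b : ℝ, b < 1 ∧ ∀ k i, c k i ≤ b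

/-- Upper estimating vectors: `diam Δ_ω ≤ C Ψ_ω`, uniformly in `ω`. -/
def IsUpperEstimating (Δ : ∀ k : ℕ, (Fin k → Fin q) → Set X) (c : ℕ → Fin q → ℝ) : Prop :=
  ∃ C : ℝ, 0 < C ∧ ∀ k (ω : Fin k → Fin q), Metric.diam (Δ k ω) ≤ C * weight c ω

/-- The word `ω` of length `k` is `(i_1, …, i_k)` for some infinite word `(i_1, i_2, …)` whose
weights satisfy `Ψ_{(i_1 … i_k)} > r` and `Ψ_{(i_1 … i_{k+1})} ≤ r`. -/
def IsStop (c : ℕ → Fin q → ℝ) (r : ℝ) {k : ℕ} (ω : Fin k → Fin q) : Prop :=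
  r < weight c ω ∧
    ∃ j : Fin q, weight c (Fin.snoc ω j : Fin (k + 1) → Fin q) ≤ r

/-- Words of the Moran covering at scale `r`: those stopping words whose cylinder is maximal,
i.e. with no proper prefix that is a stopping word.  Their cylinders partition the space of
infinite words. -/
def IsMoranWord (c : ℕ → Fin q → ℝ) (r : ℝ) {k : ℕ} (ω : Fin k → Fin q) : Prop :=
  IsStop c r ω ∧ ∀ (l : ℕ) (h : l < k), ¬ IsStop c r (wordPrefix h.le ω)

/-- The (words of the) elements `Δ_ω ∩ F` of the Moran covering of `F` at scale `r` that meet the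
open ball `B(x, r)`; the number of them is `N(x, r)`. -/
def moranCoverAt (Δ : ∀ k : ℕ, (Fin k → Fin q) → Set X) (c : ℕ → Fin q → ℝ) (x : X) (r : ℝ) :
    Set (Σ k : ℕ, Fin k → Fin q) :=
  {w | IsMoranWord c r w.2 ∧ (Δ w.1 w.2 ∩ limitSet Δ ∩ ball x r).Nonempty}

/-- Lower estimating vectors: `N(x, r)` is bounded uniformly in `x ∈ F` and `0 < r < 1`. -/
def IsLowerEstimating (Δ : ∀ k : ℕ, (Fin k → Fin q) → Set X) (c : ℕ → Fin q → ℝ) : Prop :=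
  ∃ N : ℕ, ∀ x ∈ limitSet Δ, ∀ r : ℝ, 0 < r → r < 1 → (moranCoverAt Δ c x r).encard < N

/-- Existence of Gibbs-like measures: for each `β > 0` there are a measure `m` supported on `F`
and `L > 0` with
`L⁻¹ Ψ_ω^β / ∑_{ω'} Ψ_ω'^β ≤ m(Δ_ω) ≤ L Ψ_ω^β / ∑_{ω'} Ψ_ω'^β` for all words `ω` of all lengths
`k ≥ 1`, the sums being over the words `ω'` of length `k`. -/
def HasGibbsLikeMeasures [MeasurableSpace X]
    (Δ : ∀ k : ℕ, (Fin k → Fin q) → Set X) (c : ℕ → Fin q → ℝ) : Prop :=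
  ∀ β : ℝ, 0 < β → ∃ (m : Measure X) (L : ℝ), 0 < L ∧ m (limitSet Δ)ᶜ = 0 ∧
    ∀ (k : ℕ), 1 ≤ k → ∀ ω : Fin k → Fin q,
      ENNReal.ofReal (L⁻¹ * (weight c ω ^ β / ∑ ω' : Fin k → Fin q, weight c ω' ^ β))
          ≤ m (Δ k ω) ∧
      m (Δ k ω)
          ≤ ENNReal.ofReal (L * (weight c ω ^ β / ∑ ω' : Fin k → Fin q, weight c ω' ^ β))

end Constructions

/-! ### Stochastic contraction vectors -/

/-- `μ` is (strongly) mixing for the measure-preserving map `T`. -/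
def IsMixing {M : Type*} [MeasurableSpace M] (T : M → M) (μ : Measure M) : Prop :=
  MeasurePreserving T μ μ ∧ ∀ A B : Set M, MeasurableSet A → MeasurableSet B →
    Tendsto (fun n : ℕ => μ (T^[n] ⁻¹' A ∩ B)) atTop (𝓝 (μ A * μ B))

/-- The contraction vectors `(φ_1(T_1^k x_1), …, φ_q(T_q^k x_q))` of the steps `k = 1, 2, …`;
index `k` of the sequence is step `k + 1`. -/
def stochasticVector {q : ℕ} {M : Type*} (T : Fin q → M → M) (φ : Fin q → M → ℝ)
    (x : Fin q → M) : ℕ → Fin q → ℝ :=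
  fun k i => φ i ((T i)^[k + 1] (x i))

/-- The integrand `log ∑_i φ_i(x_i)^s`. -/
def logSum {q : ℕ} {M : Type*} (φ : Fin q → M → ℝ) (s : ℝ) (x : Fin q → M) : ℝ :=
  Real.log (∑ i, φ i (x i) ^ s)

end Moran

end

/-!
The partition sums `Z_k(β) = ∑_{|ω| = k} Ψ_ω^β` factor over the steps, so `log Z_k(β)` is an ergodic
sum of `logSum φ β` for the product map on `M^q`.  That map is ergodic because its factors are
mixing (`ergodic_pi_of_isMixing`).  The pressure `P(β) = ∫ logSum φ β` is Lipschitz in `β`,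
decreases at a definite rate and equals `log q ≥ 0` at `β = 0`; so it has exactly one zero `s`, and
`s ≥ 0` (`exists_integral_logSum_eq_zero`).

The pointwise ergodic theorem is not needed.  If an integrable function has negative integral, the
maximal ergodic inequality bounds its ergodic sums from above almost everywhere
(`ae_bddAbove_birkhoffSum`).  Hence, almost surely, `Z_k(β)` is bounded in `k` for every `β > s` and
bounded away from `0` for every `β < s`.  By Borel–Cantelli the contraction numbers, though not
bounded below, decay subexponentially almost surely.  These properties are collected in
`IsCritical`, and the rest of the argument is deterministic.

Since the vectors are basic, the weights decay exponentially, so appending a letter to a word costs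
only a small power of its weight (`exists_mul_weight_rpow_le`).  For `u > s`, a Gibbs-like measure
with exponent between `s` and `u` gives every ball `B(x, r)` centred on the limit set mass at least
`κ r^u`, as such a ball contains a basic set of comparable weight (`exists_measure_le_closedBall`).
For `u < s`, a Gibbs-like measure with exponent between `u` and `s` gives the ball mass at most
`K r^u`, because boundedly many elements of the Moran covering meet it (`exists_measure_ball_le`).
Disjoint balls of large mass cannot be numerous, which bounds all three dimensions from above;
balls of small mass must be numerous in every covering and every maximal packing, which bounds them
from below (`dim_limitSet_eq`).
-/

namespace Moran

/-! ### Mixing maps and their products -/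

section Mixing

variable {M : Type*} [MeasurableSpace M]

theorem measureReal_iUnion_eq_tsum {μ : Measure M} {f : ℕ → Set M}
    (hd : Pairwise (Function.onFun Disjoint f)) (hf : ∀ i, MeasurableSet (f i)) [IsFiniteMeasure μ] :
    μ.real (⋃ i, f i) = ∑' i, μ.real (f i) := by
  rw [Measure.real, measure_iUnion hd hf, ENNReal.tsum_toReal_eq fun i => measure_ne_top _ _]
  rfl

/-- Mixing need only be tested on pairs of sets from a generating `π`-system. -/
theorem tendsto_measure_inter_of_isPiSystem {T : M → M} {μ : Measure M} [IsProbabilityMeasure μ]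
    (hT : MeasurePreserving T μ μ) {S : Set (Set M)}
    (hS : ‹MeasurableSpace M› = MeasurableSpace.generateFrom S) (hpi : IsPiSystem S)
    (h : ∀ A ∈ S, ∀ B ∈ S,
      Tendsto (fun n : ℕ => μ.real (T^[n] ⁻¹' A ∩ B)) atTop (𝓝 (μ.real A * μ.real B)))
    {A B : Set M} (hA : MeasurableSet A) (hB : MeasurableSet B) :
    Tendsto (fun n : ℕ => μ.real (T^[n] ⁻¹' A ∩ B)) atTop (𝓝 (μ.real A * μ.real B)) := by
  have hTn : ∀ n : ℕ, Measurable T^[n] := fun n => (hT.iterate n).measurable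
  have hpre : ∀ (n : ℕ) {A : Set M}, MeasurableSet A → μ.real (T^[n] ⁻¹' A) = μ.real A :=
    fun n A hA => by
      simp only [Measure.real, (hT.iterate n).measure_preimage hA.nullMeasurableSet]
  have step : ∀ B ∈ S, ∀ {A : Set M}, MeasurableSet A →
      Tendsto (fun n : ℕ => μ.real (T^[n] ⁻¹' A ∩ B)) atTop (𝓝 (μ.real A * μ.real B)) := by
    intro B hBS A hA
    have hB : MeasurableSet B := hS ▸ .basic B hBS
    induction A, hA using MeasurableSpace.induction_on_inter hS hpi with
    | empty => simp
    | basic A hA => exact h A hA B hBS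
    | compl A hA ih =>
      have e : ∀ n, μ.real (T^[n] ⁻¹' Aᶜ ∩ B) = μ.real B - μ.real (T^[n] ⁻¹' A ∩ B) := by
        intro n
        have := measureReal_inter_add_sdiff (μ := μ) (s := B) (hTn n hA)
        rw [Set.inter_comm (T^[n] ⁻¹' A), ← this, Set.preimage_compl, Set.inter_comm _ B,
          ← Set.sdiff_eq]
        ring
      simp_rw [e, measureReal_compl hA, probReal_univ, sub_mul, one_mul]
      exact ih.const_sub _
    | iUnion f hd hf ih =>
      have e : ∀ n, μ.real (T^[n] ⁻¹' (⋃ i, f i) ∩ B) = ∑' i, μ.real (T^[n] ⁻¹' (f i) ∩ B) := by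
        intro n
        rw [Set.preimage_iUnion, Set.iUnion_inter, measureReal_iUnion_eq_tsum]
        · intro i j hij
          exact ((hd hij).preimage _).mono Set.inter_subset_left Set.inter_subset_left
        · exact fun i => (hTn n (hf i)).inter hB
      simp_rw [e, measureReal_iUnion_eq_tsum hd hf, ← tsum_mul_right]
      refine tendsto_tsum_of_dominated_convergence (bound := fun i => μ.real (f i))
        ?_ ih (Eventually.of_forall fun n i => ?_)
      · exact ENNReal.summable_toReal
          (by rw [← measure_iUnion hd hf]; exact measure_ne_top _ _)
      · rw [Real.norm_of_nonneg measureReal_nonneg, ← hpre n (hf i)]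
        exact measureReal_mono Set.inter_subset_left
  induction B, hB using MeasurableSpace.induction_on_inter hS hpi with
  | empty => simp
  | basic B hB => exact step B hB hA
  | compl B hB ih =>
    have e : ∀ n, μ.real (T^[n] ⁻¹' A ∩ Bᶜ) = μ.real A - μ.real (T^[n] ⁻¹' A ∩ B) := by
      intro n
      have := measureReal_inter_add_sdiff (μ := μ) (s := T^[n] ⁻¹' A) hB
      rw [← hpre n hA, ← this, ← Set.sdiff_eq]
      ring
    simp_rw [e, measureReal_compl hB, probReal_univ, mul_sub, mul_one]
    exact ih.const_sub _
  | iUnion f hd hf ih =>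
    have e : ∀ n, μ.real (T^[n] ⁻¹' A ∩ ⋃ i, f i) = ∑' i, μ.real (T^[n] ⁻¹' A ∩ f i) := by
      intro n
      rw [Set.inter_iUnion, measureReal_iUnion_eq_tsum]
      · intro i j hij
        exact (hd hij).mono Set.inter_subset_right Set.inter_subset_right
      · exact fun i => (hTn n hA).inter (hf i)
    simp_rw [e, measureReal_iUnion_eq_tsum hd hf, ← tsum_mul_left]
    refine tendsto_tsum_of_dominated_convergence (bound := fun i => μ.real (f i))
      ?_ ih (Eventually.of_forall fun n i => ?_)
    · exact ENNReal.summable_toReal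
        (by rw [← measure_iUnion hd hf]; exact measure_ne_top _ _)
    · rw [Real.norm_of_nonneg measureReal_nonneg]
      exact measureReal_mono Set.inter_subset_right

theorem iterate_pi_apply {ι M : Type*} (T : ι → M → M) (n : ℕ) (x : ι → M) :
    (fun (y : ι → M) i => T i (y i))^[n] x = fun i => (T i)^[n] (x i) := by
  induction n with
  | zero => rfl
  | succ n ih => simp only [Function.iterate_succ_apply', ih]

/-- A finite product of mixing maps is ergodic.  (A product of ergodic maps need not be.) -/
theorem ergodic_pi_of_isMixing {ι : Type*} [Fintype ι] {T : ι → M → M} {μ : ι → Measure M}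
    [∀ i, IsProbabilityMeasure (μ i)] (h : ∀ i, IsMixing (T i) (μ i)) :
    Ergodic (fun (x : ι → M) i => T i (x i)) (Measure.pi μ) := by
  have hT : MeasurePreserving (fun (x : ι → M) i => T i (x i)) (Measure.pi μ) (Measure.pi μ) :=
    measurePreserving_pi _ _ fun i => (h i).1
  refine ⟨hT, ⟨fun A hA hinv => ?_⟩⟩
  have lim := tendsto_measure_inter_of_isPiSystem hT generateFrom_pi.symm isPiSystem_pi
    (by
      rintro _ ⟨A, hA, rfl⟩ _ ⟨B, hB, rfl⟩
      have hA' : ∀ i, MeasurableSet (A i) := fun i => hA i (Set.mem_univ i)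
      have hB' : ∀ i, MeasurableSet (B i) := fun i => hB i (Set.mem_univ i)
      have e : ∀ n : ℕ, (fun (x : ι → M) i => T i (x i))^[n] ⁻¹' Set.univ.pi A ∩ Set.univ.pi B
          = Set.univ.pi fun i => (T i)^[n] ⁻¹' A i ∩ B i := by
        intro n
        ext x
        simp [iterate_pi_apply, forall_and]
      simp_rw [e, Measure.real, Measure.pi_pi, ENNReal.toReal_prod, ← Finset.prod_mul_distrib]
      refine tendsto_finsetProd _ fun i _ => ?_
      rw [← ENNReal.toReal_mul]
      exact (ENNReal.tendsto_toReal (ENNReal.mul_ne_top (measure_ne_top _ _)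
        (measure_ne_top _ _))).comp ((h i).2 _ _ (hA' i) (hB' i)))
    hA hA
  have e : ∀ n : ℕ, (fun (x : ι → M) i => T i (x i))^[n] ⁻¹' A ∩ A = A := by
    intro n
    rw [Function.IsFixedPt.preimage_iterate hinv n, Set.inter_self]
  simp_rw [e] at lim
  have hsq := tendsto_nhds_unique tendsto_const_nhds lim
  rw [eventuallyConst_set']
  have hcase : (Measure.pi μ).real A = 0 ∨ (Measure.pi μ).real A = 1 := by
    have : (Measure.pi μ).real A * ((Measure.pi μ).real A - 1) = 0 := by linarith
    rcases mul_eq_zero.1 this with h | h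
    · exact .inl h
    · exact .inr (by linarith)
  rcases hcase with h0 | h1
  · left
    exact ae_eq_empty.2 ((measureReal_eq_zero_iff).1 h0)
  · right
    rw [ae_eq_univ, prob_compl_eq_zero_iff hA]
    rw [Measure.real] at h1
    exact (ENNReal.toReal_eq_one_iff _).1 h1

end Mixing

/-! ### One-sided bounds for ergodic sums -/

section Ergodic

variable {Ω : Type*} [MeasurableSpace Ω] {μ : Measure Ω} {T : Ω → Ω} {f : Ω → ℝ}

/-- The running maximum `max (0, S₁ f, …, Sₙ f)` of the Birkhoff sums, written recursively. -/
def birkhoffMax (T : Ω → Ω) (f : Ω → ℝ) : ℕ → Ω → ℝ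
  | 0 => 0
  | n + 1 => fun x => max 0 (f x + birkhoffMax T f n (T x))

theorem birkhoffMax_nonneg {Ω : Type*} {T : Ω → Ω} {f : Ω → ℝ} (n : ℕ)
    (x : Ω) : 0 ≤ birkhoffMax T f n x := by
  cases n with
  | zero => rfl
  | succ n => exact le_max_left _ _

theorem birkhoffMax_le_succ {Ω : Type*} {T : Ω → Ω} {f : Ω → ℝ} (n : ℕ)
    (x : Ω) : birkhoffMax T f n x ≤ birkhoffMax T f (n + 1) x := by
  induction n generalizing x with
  | zero => exact birkhoffMax_nonneg _ _
  | succ n ih => exact max_le_max le_rfl (by gcongr; exact ih _)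

theorem birkhoffSum_le_birkhoffMax {Ω : Type*} {T : Ω → Ω} {f : Ω → ℝ} (n : ℕ)
    (x : Ω) : birkhoffSum T f n x ≤ birkhoffMax T f n x := by
  induction n generalizing x with
  | zero => simp [birkhoffMax]
  | succ n ih =>
    rw [birkhoffSum_succ']
    exact le_max_of_le_right (by gcongr; exact ih _)

theorem measurable_birkhoffMax (hT : Measurable T) (hf : Measurable f) (n : ℕ) :
    Measurable (birkhoffMax T f n) := by
  induction n with
  | zero => exact measurable_const
  | succ n ih => exact measurable_const.max (hf.add (ih.comp hT))

theorem integrable_birkhoffMax [IsFiniteMeasure μ] (hT : MeasurePreserving T μ μ)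
    (hf : Integrable f μ) (n : ℕ) : Integrable (birkhoffMax T f n) μ := by
  induction n with
  | zero => exact integrable_zero _ _ _
  | succ n ih => exact (integrable_const 0).sup (hf.add (hT.integrable_comp_of_integrable ih))

/-- The maximal ergodic inequality, with Garsia's proof. -/
theorem setIntegral_birkhoffMax_pos_nonneg [IsFiniteMeasure μ] (hT : MeasurePreserving T μ μ)
    (hfm : Measurable f) (hf : Integrable f μ) (n : ℕ) :
    0 ≤ ∫ x in {x | 0 < birkhoffMax T f n x}, f x ∂μ := by
  set E := {x | 0 < birkhoffMax T f n x}
  have hM := integrable_birkhoffMax hT hf n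
  have hMT : Integrable (fun x => birkhoffMax T f n (T x)) μ := hT.integrable_comp_of_integrable hM
  have hE : MeasurableSet E := measurableSet_lt measurable_const
    (measurable_birkhoffMax hT.measurable hfm n)
  have hmp : ∫ x, birkhoffMax T f n (T x) ∂μ = ∫ x, birkhoffMax T f n x ∂μ := by
    have := integral_map (μ := μ) hT.measurable.aemeasurable
      (measurable_birkhoffMax hT.measurable hfm n).aestronglyMeasurable
    rw [hT.map_eq] at this
    exact this.symm
  rw [← integral_indicator hE]
  have hle : ∀ x, birkhoffMax T f n x - birkhoffMax T f n (T x) ≤ E.indicator f x := by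
    intro x
    by_cases hx : x ∈ E
    · rw [Set.indicator_of_mem hx]
      have h1 := birkhoffMax_le_succ (T := T) (f := f) n x
      rw [show birkhoffMax T f (n + 1) x = max 0 (f x + birkhoffMax T f n (T x)) from rfl] at h1
      rcases le_max_iff.1 h1 with h | h
      · exact absurd h (not_le.2 hx)
      · linarith
    · rw [Set.indicator_of_notMem hx]
      have h1 : birkhoffMax T f n x ≤ 0 := not_lt.1 hx
      linarith [birkhoffMax_nonneg (T := T) (f := f) n (T x)]
  calc (0 : ℝ) = ∫ x, (birkhoffMax T f n x - birkhoffMax T f n (T x)) ∂μ := by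
        rw [integral_sub hM hMT, hmp, sub_self]
    _ ≤ _ := integral_mono (hM.sub hMT) (hf.indicator hE) hle

/-- If `∫ f < 0` then almost every orbit has ergodic sums bounded above.  The set where they are
unbounded is invariant; were it of full measure, the maximal ergodic inequality would give
`0 ≤ ∫ f`. -/
theorem ae_bddAbove_birkhoffSum [IsProbabilityMeasure μ] (hT : Ergodic T μ)
    (hfm : Measurable f) (hf : Integrable f μ) (hneg : ∫ x, f x ∂μ < 0) :
    ∀ᵐ x ∂μ, ∃ C : ℝ, ∀ n, birkhoffSum T f n x ≤ C := by
  have hTm := hT.toMeasurePreserving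
  have hS : ∀ n, Measurable (birkhoffSum T f n) := fun n => by
    change Measurable fun x => ∑ k ∈ Finset.range n, f (T^[k] x)
    exact Finset.measurable_fun_sum _ fun i _ => hfm.comp (hTm.iterate i).measurable
  have hset : {x | ∃ C : ℝ, ∀ n, birkhoffSum T f n x ≤ C}
      = ⋃ N : ℕ, ⋂ n : ℕ, {x | birkhoffSum T f n x ≤ N} := by
    ext x
    simp only [Set.mem_ofPred_eq, Set.mem_iUnion, Set.mem_iInter]
    constructor
    · rintro ⟨C, hC⟩
      obtain ⟨N, hN⟩ := exists_nat_ge C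
      exact ⟨N, fun n => (hC n).trans hN⟩
    · rintro ⟨N, hN⟩
      exact ⟨N, hN⟩
  have hmeas : MeasurableSet {x | ∃ C : ℝ, ∀ n, birkhoffSum T f n x ≤ C} := by
    rw [hset]
    exact .iUnion fun N => .iInter fun n => measurableSet_le (hS n) measurable_const
  have hinv : T ⁻¹' {x | ∃ C : ℝ, ∀ n, birkhoffSum T f n x ≤ C}
      = {x | ∃ C : ℝ, ∀ n, birkhoffSum T f n x ≤ C} := by
    ext x
    simp only [Set.mem_preimage, Set.mem_ofPred_eq]
    constructor
    · rintro ⟨C, hC⟩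
      refine ⟨max 0 (f x + C), fun n => ?_⟩
      cases n with
      | zero => simp
      | succ n =>
        rw [birkhoffSum_succ']
        exact le_max_of_le_right (by gcongr; exact hC n)
    · rintro ⟨C, hC⟩
      refine ⟨C - f x, fun n => ?_⟩
      have := hC (n + 1)
      rw [birkhoffSum_succ'] at this
      linarith
  rcases hT.toPreErgodic.ae_mem_or_ae_notMem hmeas hinv with h | h
  · exact h
  exfalso
  have hlim : Tendsto (fun n => ∫ x in {x | 0 < birkhoffMax T f n x}, f x ∂μ) atTop
      (𝓝 (∫ x, f x ∂μ)) := by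
    have hE : ∀ n, MeasurableSet {x | 0 < birkhoffMax T f n x} := fun n =>
      measurableSet_lt measurable_const (measurable_birkhoffMax hTm.measurable hfm n)
    simp_rw [← integral_indicator (hE _)]
    refine tendsto_integral_of_dominated_convergence (fun x => |f x|)
      (fun n => (hf.indicator (hE n)).aestronglyMeasurable) hf.abs
      (fun n => Eventually.of_forall fun x => ?_) ?_
    · exact norm_indicator_le_norm_self _ _
    · filter_upwards [h] with x hx
      simp only [not_exists, not_forall, not_le] at hx
      obtain ⟨N, hN⟩ := hx 0
      refine tendsto_const_nhds.congr' ?_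
      filter_upwards [eventually_ge_atTop N] with n hn
      have : 0 < birkhoffMax T f n x := (hN.trans_le (birkhoffSum_le_birkhoffMax N x)).trans_le
        (monotone_nat_of_le_succ (f := fun n => birkhoffMax T f n x)
          (fun n => birkhoffMax_le_succ n x) hn)
      rw [Set.indicator_of_mem (s := {x | 0 < birkhoffMax T f n x}) this]
  exact absurd (ge_of_tendsto' hlim fun n =>
    setIntegral_birkhoffMax_pos_nonneg hTm hfm hf n) (not_le.2 hneg)

/-- Along almost every orbit an integrable nonnegative function grows sublinearly
(Borel–Cantelli). -/
theorem ae_exists_forall_iterate_le [IsProbabilityMeasure μ] (hT : MeasurePreserving T μ μ)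
    (hfm : Measurable f) (hf : Integrable f μ) (h0 : 0 ≤ f) {δ : ℝ} (hδ : 0 < δ) :
    ∀ᵐ x ∂μ, ∃ C : ℝ, ∀ k : ℕ, f (T^[k] x) ≤ C + δ * k := by
  let _ : MeasureSpace Ω := ⟨μ⟩
  have hsum := ProbabilityTheory.tsum_prob_mem_Ioi_lt_top (Ω := Ω) (X := fun x => f x / δ)
    (hf.div_const δ) (fun x => div_nonneg (h0 x) hδ.le)
  have hsum' : ∑' k : ℕ, μ (T^[k] ⁻¹' {x | f x / δ ∈ Set.Ioi (k : ℝ)}) ≠ ∞ := by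
    have hm : ∀ k : ℕ, MeasurableSet {x | f x / δ ∈ Set.Ioi (k : ℝ)} := fun k =>
      (hfm.div_const δ) measurableSet_Ioi
    simp_rw [(hT.iterate _).measure_preimage (hm _).nullMeasurableSet]
    exact hsum.ne
  filter_upwards [ae_eventually_notMem hsum'] with x hx
  obtain ⟨N, hN⟩ := eventually_atTop.1 hx
  refine ⟨∑ k ∈ Finset.range N, f (T^[k] x), fun k => ?_⟩
  have hs : 0 ≤ ∑ k ∈ Finset.range N, f (T^[k] x) := Finset.sum_nonneg fun i _ => h0 _
  rcases lt_or_ge k N with hk | hk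
  · have := Finset.single_le_sum (f := fun k => f (T^[k] x)) (fun i _ => h0 _)
      (Finset.mem_range.2 hk)
    have h2 : 0 ≤ δ * k := by positivity
    linarith
  · have := hN k hk
    simp only [Set.mem_preimage, Set.mem_Ioi, Set.mem_ofPred_eq, not_lt] at this
    rw [div_le_iff₀ hδ] at this
    linarith

end Ergodic

/-! ### The pressure function -/

section Pressure

variable {q : ℕ} {M : Type*} [MeasurableSpace M]

/-- Perturbing the exponent by `u` changes `log ∑ aᵢ^t` by at most `maxᵢ u log aᵢ`. -/
theorem log_sum_rpow_add_le [NeZero q] {a : Fin q → ℝ} (ha : ∀ i, 0 < a i) {t u w : ℝ}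
    (h : ∀ i, u * Real.log (a i) ≤ w) :
    Real.log (∑ i, a i ^ (t + u)) ≤ Real.log (∑ i, a i ^ t) + w := by
  have hpos : ∀ v : ℝ, 0 < ∑ i, a i ^ v := fun v =>
    Finset.sum_pos (fun i _ => Real.rpow_pos_of_pos (ha i) v) Finset.univ_nonempty
  rw [← Real.log_exp w, ← Real.log_mul (hpos t).ne' (Real.exp_pos _).ne']
  refine Real.log_le_log (hpos _) ?_
  rw [Finset.sum_mul]
  refine Finset.sum_le_sum fun i _ => ?_
  rw [Real.rpow_add (ha i)]
  refine mul_le_mul_of_nonneg_left ?_ (Real.rpow_nonneg (ha i).le _)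
  rw [Real.rpow_def_of_pos (ha i), mul_comm]
  exact Real.exp_le_exp.2 (h i)

variable {μ : Fin q → Measure M} [∀ i, IsProbabilityMeasure (μ i)] {φ : Fin q → M → ℝ}

theorem ae_pi_forall_of_forall_ae {ι : Type*} [Fintype ι] {μ : ι → Measure M}
    [∀ i, IsProbabilityMeasure (μ i)] {p : ι → M → Prop} (h : ∀ i, ∀ᵐ y ∂μ i, p i y) :
    ∀ᵐ x ∂Measure.pi μ, ∀ i, p i (x i) :=
  ae_all_iff.2 fun i => (Measure.quasiMeasurePreserving_eval μ i).ae (h i)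

theorem integrable_log_eval (hφlog : ∀ i, Integrable (fun y => Real.log (φ i y)) (μ i))
    (i : Fin q) : Integrable (fun x : Fin q → M => Real.log (φ i (x i))) (Measure.pi μ) :=
  (measurePreserving_eval μ i).integrable_comp_of_integrable (hφlog i)

theorem measurable_logSum (hφm : ∀ i, Measurable (φ i)) (t : ℝ) : Measurable (logSum φ t) := by
  refine Real.measurable_log.comp (Finset.measurable_fun_sum _ fun i _ => ?_)
  exact ((hφm i).comp (measurable_pi_apply i)).pow_const t

theorem logSum_zero {M : Type*} {φ : Fin q → M → ℝ} (x : Fin q → M) : logSum φ 0 x = Real.log q := by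
  simp [logSum]

variable [NeZero q]

theorem abs_logSum_le {M : Type*} {φ : Fin q → M → ℝ} {x : Fin q → M} (hx : ∀ i, 0 < φ i (x i))
    (t : ℝ) : |logSum φ t x| ≤ Real.log q + |t| * ∑ i, |Real.log (φ i (x i))| := by
  have hb : ∀ (u : ℝ) (i : Fin q),
      u * Real.log (φ i (x i)) ≤ |u| * ∑ i, |Real.log (φ i (x i))| := by
    intro u i
    refine (le_abs_self _).trans ?_
    rw [abs_mul]
    gcongr
    exact Finset.single_le_sum (f := fun i => |Real.log (φ i (x i))|)
      (fun i _ => abs_nonneg _) (Finset.mem_univ i)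
  have h1 := log_sum_rpow_add_le hx (t := 0) (hb t)
  have h2 := log_sum_rpow_add_le hx (t := t) (hb (-t))
  have h0 := logSum_zero (φ := φ) x
  have hq : 0 ≤ Real.log q := Real.log_natCast_nonneg q
  simp only [add_neg_cancel, zero_add, abs_neg] at h1 h2
  simp only [logSum] at h0 ⊢
  rw [abs_le]
  constructor <;> linarith

theorem integrable_logSum (hφm : ∀ i, Measurable (φ i)) (hφpos : ∀ i, ∀ᵐ y ∂(μ i), 0 < φ i y)
    (hφlog : ∀ i, Integrable (fun y => Real.log (φ i y)) (μ i)) (t : ℝ) :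
    Integrable (logSum φ t) (Measure.pi μ) := by
  refine Integrable.mono' (g := fun x => Real.log q + |t| * ∑ i, |Real.log (φ i (x i))|) ?_
    (measurable_logSum hφm t).aestronglyMeasurable ?_
  · exact (integrable_const _).add
      ((integrable_finsetSum _ fun i _ => (integrable_log_eval hφlog i).abs).const_mul _)
  · filter_upwards [ae_pi_forall_of_forall_ae hφpos] with x hx
    exact abs_logSum_le hx t

theorem integral_logSum_add_le (hφm : ∀ i, Measurable (φ i))
    (hφpos : ∀ i, ∀ᵐ y ∂(μ i), 0 < φ i y)
    (hφlog : ∀ i, Integrable (fun y => Real.log (φ i y)) (μ i)) {t u : ℝ} {W : (Fin q → M) → ℝ}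
    (hW : Integrable W (Measure.pi μ)) (h : ∀ x i, u * Real.log (φ i (x i)) ≤ W x) :
    ∫ x, logSum φ (t + u) x ∂(Measure.pi μ)
      ≤ ∫ x, logSum φ t x ∂(Measure.pi μ) + ∫ x, W x ∂(Measure.pi μ) := by
  have hi := integrable_logSum hφm hφpos hφlog
  rw [← integral_add (hi t) hW]
  refine integral_mono_ae (hi _) ((hi t).add hW) ?_
  filter_upwards [ae_pi_forall_of_forall_ae hφpos] with x hx
  exact log_sum_rpow_add_le hx (h x)

theorem lipschitzWith_integral_logSum (hφm : ∀ i, Measurable (φ i))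
    (hφpos : ∀ i, ∀ᵐ y ∂(μ i), 0 < φ i y)
    (hφlog : ∀ i, Integrable (fun y => Real.log (φ i y)) (μ i)) :
    ∃ K : ℝ≥0, LipschitzWith K fun t => ∫ x, logSum φ t x ∂(Measure.pi μ) := by
  have hH : Integrable (fun x : Fin q → M => ∑ i, |Real.log (φ i (x i))|) (Measure.pi μ) :=
    integrable_finsetSum _ fun i _ => (integrable_log_eval hφlog i).abs
  refine ⟨_, LipschitzWith.of_le_add_mul'
    (∫ x : Fin q → M, ∑ i, |Real.log (φ i (x i))| ∂(Measure.pi μ)) fun t' t => ?_⟩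
  have := integral_logSum_add_le hφm hφpos hφlog (t := t) (u := t' - t)
    (hH.const_mul |t' - t|) (fun x i => by
      refine (le_abs_self _).trans ?_
      rw [abs_mul]
      gcongr
      exact Finset.single_le_sum (f := fun i => |Real.log (φ i (x i))|)
        (fun i _ => abs_nonneg _) (Finset.mem_univ i))
  rw [integral_const_mul, add_sub_cancel] at this
  rw [Real.dist_eq]
  linarith

/-- The pressure decreases at a definite rate, namely `-∫ maxᵢ log φᵢ > 0`. -/
theorem exists_integral_logSum_add_le (hφm : ∀ i, Measurable (φ i))
    (hφ1 : ∀ i y, φ i y < 1) (hφpos : ∀ i, ∀ᵐ y ∂(μ i), 0 < φ i y)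
    (hφlog : ∀ i, Integrable (fun y => Real.log (φ i y)) (μ i)) :
    ∃ l : ℝ, 0 < l ∧ ∀ t u : ℝ, 0 ≤ u →
      ∫ x, logSum φ (t + u) x ∂(Measure.pi μ)
        ≤ ∫ x, logSum φ t x ∂(Measure.pi μ) - u * l := by
  set G : (Fin q → M) → ℝ := fun x => ⨆ i, Real.log (φ i (x i))
  have hGm : Measurable G :=
    .iSup fun i => Real.measurable_log.comp ((hφm i).comp (measurable_pi_apply i))
  have hle : ∀ x i, Real.log (φ i (x i)) ≤ G x := fun x i =>
    le_ciSup (f := fun i => Real.log (φ i (x i))) (Set.finite_range _).bddAbove i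
  have hmem : ∀ x, ∃ i, Real.log (φ i (x i)) = G x := fun x =>
    exists_eq_ciSup_of_finite
  have hG : Integrable G (Measure.pi μ) := by
    refine Integrable.mono' (g := fun x => ∑ i, |Real.log (φ i (x i))|)
      (integrable_finsetSum _ fun i _ => (integrable_log_eval hφlog i).abs)
      hGm.aestronglyMeasurable (Eventually.of_forall fun x => ?_)
    obtain ⟨i, hi⟩ := hmem x
    rw [← hi]
    exact Finset.single_le_sum (f := fun i => |Real.log (φ i (x i))|)
      (fun i _ => abs_nonneg _) (Finset.mem_univ i)
  have hneg : ∀ᵐ x ∂Measure.pi μ, 0 < -G x := by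
    filter_upwards [ae_pi_forall_of_forall_ae hφpos] with x hx
    obtain ⟨i, hi⟩ := hmem x
    rw [← hi]
    exact neg_pos.2 (Real.log_neg (hx i) (hφ1 i _))
  refine ⟨∫ x, -G x ∂(Measure.pi μ), ?_, fun t u hu => ?_⟩
  · rw [integral_pos_iff_support_of_nonneg_ae (hneg.mono fun x hx => hx.le) hG.neg]
    have : Function.support (fun x => -G x) =ᵐ[Measure.pi μ] Set.univ :=
      eventuallyEq_univ.2 (hneg.mono fun x hx => hx.ne')
    rw [measure_congr this]
    simp
  · have := integral_logSum_add_le hφm hφpos hφlog (t := t) (u := u) (hG.const_mul u)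
      (fun x i => mul_le_mul_of_nonneg_left (hle x i) hu)
    rw [integral_const_mul] at this
    rw [integral_neg]
    linarith

/-- The pressure has exactly one zero `s`; it is nonnegative, the pressure is positive to the left
of `s` and negative to the right. -/
theorem exists_integral_logSum_eq_zero (hφm : ∀ i, Measurable (φ i))
    (hφ1 : ∀ i y, φ i y < 1) (hφpos : ∀ i, ∀ᵐ y ∂(μ i), 0 < φ i y)
    (hφlog : ∀ i, Integrable (fun y => Real.log (φ i y)) (μ i)) :
    ∃ s : ℝ, 0 ≤ s ∧ ∫ x, logSum φ s x ∂(Measure.pi μ) = 0 ∧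
      (∀ t, t < s → 0 < ∫ x, logSum φ t x ∂(Measure.pi μ)) ∧
      ∀ t, s < t → ∫ x, logSum φ t x ∂(Measure.pi μ) < 0 := by
  obtain ⟨l, hl, hdec⟩ := exists_integral_logSum_add_le hφm hφ1 hφpos hφlog
  obtain ⟨K, hK⟩ := lipschitzWith_integral_logSum hφm hφpos hφlog
  have h0 : ∫ x, logSum φ 0 x ∂(Measure.pi μ) = Real.log q := by simp [logSum_zero]
  have hq : 0 ≤ Real.log q := Real.log_natCast_nonneg q
  have hb : 0 ≤ Real.log q / l := div_nonneg hq hl.le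
  have h1 := hdec 0 (Real.log q / l) hb
  rw [h0, div_mul_cancel₀ _ hl.ne', sub_self, zero_add] at h1
  obtain ⟨s, hs, hs0⟩ := intermediate_value_Icc' hb hK.continuous.continuousOn
    (show (0 : ℝ) ∈ Set.Icc _ _ from ⟨h1, h0 ▸ hq⟩)
  simp only at hs0
  refine ⟨s, hs.1, hs0, fun t ht => ?_, fun t ht => ?_⟩
  · have := hdec t (s - t) (by linarith)
    rw [add_sub_cancel, hs0] at this
    have h2 : 0 < (s - t) * l := mul_pos (by linarith) hl
    linarith
  · have := hdec s (t - s) (by linarith)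
    rw [add_sub_cancel, hs0] at this
    have h2 : 0 < (t - s) * l := mul_pos (by linarith) hl
    linarith

end Pressure

/-! ### Almost sure behaviour of the stochastic contraction vectors -/

section Weights

variable {q : ℕ} {c : ℕ → Fin q → ℝ}

theorem weight_pos (hc : ∀ k i, 0 < c k i) {k : ℕ} (ω : Fin k → Fin q) : 0 < weight c ω :=
  Finset.prod_pos fun j _ => hc j (ω j)

theorem weight_le_one (hc : ∀ k i, 0 < c k i) (hc1 : ∀ k i, c k i < 1) {k : ℕ}
    (ω : Fin k → Fin q) : weight c ω ≤ 1 :=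
  Finset.prod_le_one (fun j _ => (hc j (ω j)).le) fun j _ => (hc1 j (ω j)).le

theorem weight_snoc {k : ℕ} (ω : Fin k → Fin q) (i : Fin q) :
    weight c (Fin.snoc ω i : Fin (k + 1) → Fin q) = weight c ω * c k i := by
  simp [weight, Fin.prod_univ_castSucc]

theorem sum_weight_rpow (hc : ∀ k i, 0 < c k i) (β : ℝ) (k : ℕ) :
    ∑ ω : Fin k → Fin q, weight c ω ^ β = ∏ j : Fin k, ∑ i, c j i ^ β := by
  rw [Finset.prod_univ_sum, Fintype.piFinset_univ]
  refine Finset.sum_congr rfl fun ω _ => ?_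
  exact (Real.finsetProd_rpow Finset.univ (fun j : Fin k => c j (ω j))
      (fun j _ => (hc j (ω j)).le) β).symm

theorem sum_weight_rpow_anti (hc : ∀ k i, 0 < c k i) (hc1 : ∀ k i, c k i < 1) {β γ : ℝ}
    (h : β ≤ γ) (k : ℕ) :
    ∑ ω : Fin k → Fin q, weight c ω ^ γ ≤ ∑ ω : Fin k → Fin q, weight c ω ^ β :=
  Finset.sum_le_sum fun ω _ =>
    Real.rpow_le_rpow_of_exponent_ge (weight_pos hc ω) (weight_le_one hc hc1 ω) h

/-- The properties of a sequence of contraction vectors that hold almost surely and determine the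
dimension of the limit set: `s` is the critical exponent of the partition sums
`∑_{|ω| = k} Ψ_ω^β`, and the contraction numbers decay subexponentially. -/
structure IsCritical (c : ℕ → Fin q → ℝ) (s : ℝ) : Prop where
  pos : ∀ k i, 0 < c k i
  lt_one : ∀ k i, c k i < 1
  sum_le : ∀ β, s < β → ∃ K : ℝ, ∀ k, ∑ ω : Fin k → Fin q, weight c ω ^ β ≤ K
  le_sum : ∀ β, β < s → ∃ K : ℝ, 0 < K ∧ ∀ k, K ≤ ∑ ω : Fin k → Fin q, weight c ω ^ β
  subexp : ∀ δ : ℝ, 0 < δ → ∃ ρ : ℝ, 0 < ρ ∧ ∀ (k : ℕ) i, ρ * Real.exp (-(δ * k)) ≤ c k i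

end Weights

section Stochastic

variable {q : ℕ} {M : Type*} [MeasurableSpace M] {T : Fin q → M → M}
  {μ : Fin q → Measure M} [∀ i, IsProbabilityMeasure (μ i)] {φ : Fin q → M → ℝ}

theorem logSum_iterate_pi {q : ℕ} {M : Type*} {φ : Fin q → M → ℝ}
    (T : Fin q → M → M) (β : ℝ) (k : ℕ) (x : Fin q → M) :
    logSum φ β ((fun (y : Fin q → M) i => T i (y i))^[k] x)
      = Real.log (∑ i, φ i ((T i)^[k] (x i)) ^ β) := by
  rw [iterate_pi_apply]
  rfl

theorem ae_stochasticVector_pos (hT : ∀ i, MeasurePreserving (T i) (μ i) (μ i))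
    (hφpos : ∀ i, ∀ᵐ y ∂(μ i), 0 < φ i y) :
    ∀ᵐ x ∂(Measure.pi μ), ∀ k i, 0 < stochasticVector T φ x k i := by
  rw [ae_all_iff]
  exact fun k => ae_pi_forall_of_forall_ae fun i =>
    ((hT i).iterate (k + 1)).quasiMeasurePreserving.ae (hφpos i)

theorem ae_stochasticVector_subexp (hT : ∀ i, MeasurePreserving (T i) (μ i) (μ i))
    (hφm : ∀ i, Measurable (φ i)) (hφ : ∀ i y, 0 ≤ φ i y ∧ φ i y < 1)
    (hφpos : ∀ i, ∀ᵐ y ∂(μ i), 0 < φ i y)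
    (hφlog : ∀ i, Integrable (fun y => Real.log (φ i y)) (μ i)) {δ : ℝ} (hδ : 0 < δ) :
    ∀ᵐ x ∂(Measure.pi μ), ∃ ρ : ℝ, 0 < ρ ∧
      ∀ (k : ℕ) i, ρ * Real.exp (-(δ * k)) ≤ stochasticVector T φ x k i := by
  have h1 : ∀ i, ∀ᵐ y ∂(μ i), ∃ C : ℝ, ∀ k : ℕ, -Real.log (φ i ((T i)^[k] y)) ≤ C + δ * k :=
    fun i => ae_exists_forall_iterate_le (f := fun y => -Real.log (φ i y)) (hT i)
      (Real.measurable_log.comp (hφm i)).neg (hφlog i).neg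
      (fun y => neg_nonneg.2 (Real.log_nonpos (hφ i y).1 (hφ i y).2.le)) hδ
  filter_upwards [ae_pi_forall_of_forall_ae h1, ae_stochasticVector_pos hT hφpos] with x hx hpos
  choose C hC using hx
  refine ⟨Real.exp (-(∑ i, |C i| + δ)), Real.exp_pos _, fun k i => ?_⟩
  rw [← Real.exp_add, ← Real.le_log_iff_exp_le (hpos k i)]
  have h2 := hC i (k + 1)
  have h3 := Finset.single_le_sum (f := fun i => |C i|) (fun i _ => abs_nonneg _)
    (Finset.mem_univ i)
  have h4 := le_abs_self (C i)
  push_cast at h2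
  simp only [stochasticVector]
  linarith

variable [NeZero q]

/-- The logarithm of the partition sum is an ergodic sum of `logSum`. -/
theorem log_sum_weight_rpow_stochasticVector {M : Type*} {T : Fin q → M → M}
    {φ : Fin q → M → ℝ} {x : Fin q → M}
    (hx : ∀ k i, 0 < stochasticVector T φ x k i) (β : ℝ) (k : ℕ) :
    Real.log (∑ ω : Fin k → Fin q, weight (stochasticVector T φ x) ω ^ β)
      = birkhoffSum (fun (y : Fin q → M) i => T i (y i)) (logSum φ β) k
          (fun i => T i (x i)) := by
  rw [sum_weight_rpow hx, Real.log_prod]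
  · rw [birkhoffSum, ← Fin.sum_univ_eq_sum_range
      (fun j => logSum φ β ((fun (y : Fin q → M) i => T i (y i))^[j] fun i => T i (x i)))]
    refine Finset.sum_congr rfl fun j _ => ?_
    rw [logSum_iterate_pi]
    rfl
  · exact fun j _ => (Finset.sum_pos (fun i _ => Real.rpow_pos_of_pos (hx j i) β)
      Finset.univ_nonempty).ne'

theorem ae_sum_weight_rpow_le (hmix : ∀ i, IsMixing (T i) (μ i)) (hφm : ∀ i, Measurable (φ i))
    (hφpos : ∀ i, ∀ᵐ y ∂(μ i), 0 < φ i y)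
    (hφlog : ∀ i, Integrable (fun y => Real.log (φ i y)) (μ i)) {β : ℝ}
    (hβ : ∫ x, logSum φ β x ∂(Measure.pi μ) < 0) :
    ∀ᵐ x ∂(Measure.pi μ), ∃ K : ℝ, ∀ k,
      ∑ ω : Fin k → Fin q, weight (stochasticVector T φ x) ω ^ β ≤ K := by
  have hE := ergodic_pi_of_isMixing hmix
  have hS := hE.toMeasurePreserving.quasiMeasurePreserving.ae
    (ae_bddAbove_birkhoffSum hE (measurable_logSum hφm β)
      (integrable_logSum hφm hφpos hφlog β) hβ)
  filter_upwards [hS, ae_stochasticVector_pos (fun i => (hmix i).1) hφpos] with x hx hpos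
  obtain ⟨C, hC⟩ := hx
  refine ⟨Real.exp C, fun k => ?_⟩
  rw [← Real.log_le_iff_le_exp (Finset.sum_pos
    (fun ω _ => Real.rpow_pos_of_pos (weight_pos hpos ω) β) Finset.univ_nonempty),
    log_sum_weight_rpow_stochasticVector hpos]
  exact hC k

theorem ae_le_sum_weight_rpow (hmix : ∀ i, IsMixing (T i) (μ i)) (hφm : ∀ i, Measurable (φ i))
    (hφpos : ∀ i, ∀ᵐ y ∂(μ i), 0 < φ i y)
    (hφlog : ∀ i, Integrable (fun y => Real.log (φ i y)) (μ i)) {β : ℝ}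
    (hβ : 0 < ∫ x, logSum φ β x ∂(Measure.pi μ)) :
    ∀ᵐ x ∂(Measure.pi μ), ∃ K : ℝ, 0 < K ∧ ∀ k,
      K ≤ ∑ ω : Fin k → Fin q, weight (stochasticVector T φ x) ω ^ β := by
  have hE := ergodic_pi_of_isMixing hmix
  have hS := hE.toMeasurePreserving.quasiMeasurePreserving.ae
    (ae_bddAbove_birkhoffSum (f := -logSum φ β) hE (measurable_logSum hφm β).neg
      (integrable_logSum hφm hφpos hφlog β).neg (by
        simp only [Pi.neg_apply, integral_neg]
        linarith))
  filter_upwards [hS, ae_stochasticVector_pos (fun i => (hmix i).1) hφpos] with x hx hpos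
  obtain ⟨C, hC⟩ := hx
  refine ⟨Real.exp (-C), Real.exp_pos _, fun k => ?_⟩
  rw [← Real.le_log_iff_exp_le (Finset.sum_pos
    (fun ω _ => Real.rpow_pos_of_pos (weight_pos hpos ω) β) Finset.univ_nonempty),
    log_sum_weight_rpow_stochasticVector hpos]
  have := hC k
  rw [birkhoffSum_neg] at this
  linarith

theorem ae_isCritical_stochasticVector (hmix : ∀ i, IsMixing (T i) (μ i))
    (hφm : ∀ i, Measurable (φ i)) (hφ : ∀ i y, 0 ≤ φ i y ∧ φ i y < 1)
    (hφpos : ∀ i, ∀ᵐ y ∂(μ i), 0 < φ i y)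
    (hφlog : ∀ i, Integrable (fun y => Real.log (φ i y)) (μ i)) {s : ℝ}
    (hleft : ∀ t, t < s → 0 < ∫ x, logSum φ t x ∂(Measure.pi μ))
    (hright : ∀ t, s < t → ∫ x, logSum φ t x ∂(Measure.pi μ) < 0) :
    ∀ᵐ x ∂(Measure.pi μ), IsCritical (stochasticVector T φ x) s := by
  have hT : ∀ i, MeasurePreserving (T i) (μ i) (μ i) := fun i => (hmix i).1
  have hn : ∀ n : ℕ, 0 < 1 / ((n : ℝ) + 1) := fun n => Nat.one_div_pos_of_nat
  -- By monotonicity in the exponent, countably many exponents suffice.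
  filter_upwards [ae_stochasticVector_pos hT hφpos,
    ae_all_iff.2 fun n : ℕ => ae_sum_weight_rpow_le hmix hφm hφpos hφlog
      (hright (s + 1 / ((n : ℝ) + 1)) (by linarith [hn n])),
    ae_all_iff.2 fun n : ℕ => ae_le_sum_weight_rpow hmix hφm hφpos hφlog
      (hleft (s - 1 / ((n : ℝ) + 1)) (by linarith [hn n])),
    ae_all_iff.2 fun n : ℕ => ae_stochasticVector_subexp hT hφm hφ hφpos hφlog (hn n)]
    with x hpos hU hL hsub
  have hlt : ∀ k i, stochasticVector T φ x k i < 1 := fun k i => (hφ i _).2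
  refine ⟨hpos, hlt, fun β hβ => ?_, fun β hβ => ?_, fun δ hδ => ?_⟩
  · obtain ⟨n, hn⟩ := exists_nat_one_div_lt (sub_pos.2 hβ)
    obtain ⟨K, hK⟩ := hU n
    exact ⟨K, fun k => (sum_weight_rpow_anti hpos hlt (by linarith) k).trans (hK k)⟩
  · obtain ⟨n, hn⟩ := exists_nat_one_div_lt (sub_pos.2 hβ)
    obtain ⟨K, hK0, hK⟩ := hL n
    exact ⟨K, hK0, fun k => (hK k).trans (sum_weight_rpow_anti hpos hlt (by linarith) k)⟩
  · obtain ⟨n, hn⟩ := exists_nat_one_div_lt hδ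
    obtain ⟨ρ, hρ0, hρ⟩ := hsub n
    refine ⟨ρ, hρ0, fun k i => le_trans ?_ (hρ k i)⟩
    gcongr

end Stochastic

/-! ### Separated sets and packings -/

section Packings

variable {X : Type*} [MetricSpace X]

theorem disjoint_closedBall_of_isSeparated {C : Set X} {ε : ℝ≥0} (hC : IsSeparated (2 * ε : ℝ≥0) C)
    {x y : X} (hx : x ∈ C) (hy : y ∈ C) (hxy : x ≠ y) :
    Disjoint (closedBall x (ε : ℝ)) (closedBall y (ε : ℝ)) := by
  have h := hC hx hy hxy
  beta_reduce at h
  rw [edist_nndist, ENNReal.coe_lt_coe, ← NNReal.coe_lt_coe, coe_nndist] at h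
  push_cast at h
  exact closedBall_disjoint_closedBall (by linarith)

theorem exists_maximal_isSeparated (ε : ℝ≥0) (A : Set X) :
    ∃ C, Maximal (fun C => C ⊆ A ∧ IsSeparated ε C) C := by
  refine zorn_subset {C | C ⊆ A ∧ IsSeparated ε C} fun c hc hchain =>
    ⟨⋃₀ c, ⟨Set.sUnion_subset fun s hs => (hc hs).1, ?_⟩, fun s hs => Set.subset_sUnion_of_mem hs⟩
  exact (Set.pairwise_sUnion hchain.directedOn).2 fun s hs => (hc hs).2

theorem packingPremeasure_empty (s : ℝ) : packingPremeasure s (∅ : Set X) = 0 := by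
  refine le_antisymm (iInf₂_le_of_le 1 one_pos (iSup₂_le fun B hB => ?_)) bot_le
  have : B = ∅ := Set.eq_empty_of_forall_notMem fun p hp => (hB.1 p hp).1
  subst this
  simp

theorem packingPremeasure_mono (s : ℝ) {A B : Set X} (h : A ⊆ B) :
    packingPremeasure s A ≤ packingPremeasure s B :=
  iInf₂_mono fun _ _ => iSup_le fun P => iSup_le fun hP =>
    le_iSup₂_of_le P ⟨fun p hp => ⟨h (hP.1 p hp).1, (hP.1 p hp).2⟩, hP.2⟩ le_rfl

end Packings

/-! ### Upper bounds on dimensions from measures with large balls -/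

section LargeBalls

variable {X : Type*} [MetricSpace X] [MeasurableSpace X] [BorelSpace X] {F : Set X}

variable {m : Measure X} [IsFiniteMeasure m] {κ u : ℝ}

/-- A volume bound: a set all of whose balls of radius `r` have measure at least `κ r^u` has an
`ε`-net of cardinality at most a constant times `ε^{-u}`. -/
theorem exists_finset_isCover (hκ : 0 < κ)
    (h : ∀ x ∈ F, ∀ r : ℝ, 0 < r → r < 1 → ENNReal.ofReal (κ * r ^ u) ≤ m (closedBall x r))
    {ε : ℝ≥0} (hε : 0 < ε) (hε1 : ε < 1) :
    ∃ C : Finset X, IsCover ε F (C : Set X) ∧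
      (C.card : ℝ) ≤ m.real Set.univ / κ * 2 ^ u * (ε : ℝ) ^ (-u) := by
  have hεr : 0 < (ε : ℝ) := hε
  have hεr1 : (ε : ℝ) < 1 := hε1
  have h2 : 2 * (ε / 2) = ε := by field_simp
  have hb : 0 < κ * ((ε : ℝ) / 2) ^ u := mul_pos hκ (Real.rpow_pos_of_pos (by positivity) u)
  have hsep : ∀ C ⊆ F, IsSeparated ε C →
      (C.encard : ℝ≥0∞) * ENNReal.ofReal (κ * ((ε : ℝ) / 2) ^ u) ≤ m Set.univ := by
    intro C hCF hC
    rw [← ENNReal.tsum_set_const]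
    refine le_trans (ENNReal.tsum_le_tsum fun x : C =>
      h x (hCF x.2) ((ε : ℝ) / 2) (by positivity) (by linarith)) ?_
    refine (tsum_meas_le_meas_iUnion_of_disjoint m (fun _ => isClosed_closedBall.measurableSet)
      fun x y hxy => ?_).trans (measure_mono (Set.subset_univ _))
    have := disjoint_closedBall_of_isSeparated (ε := ε / 2) (by rwa [h2]) x.2 y.2
      (fun e => hxy (Subtype.ext e))
    simpa using this
  have htop : packingNumber ε F ≠ ⊤ := by
    intro htop
    have hlt : m Set.univ / ENNReal.ofReal (κ * ((ε : ℝ) / 2) ^ u) < ∞ :=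
      ENNReal.div_lt_top (measure_ne_top _ _) (ENNReal.ofReal_pos.2 hb).ne'
    obtain ⟨n, hn⟩ := ENNReal.exists_nat_gt hlt.ne
    have hn' : (n : ℕ∞) < packingNumber ε F := htop ▸ ENat.natCast_lt_top n
    simp only [packingNumber, lt_iSup_iff] at hn'
    obtain ⟨C, hCF, hC, hnC⟩ := hn'
    have := hsep C hCF hC
    rw [← ENNReal.le_div_iff_mul_le (.inl (ENNReal.ofReal_pos.2 hb).ne')
      (.inl ENNReal.ofReal_ne_top)] at this
    have h3 : ((n : ℕ∞) : ℝ≥0∞) ≤ (C.encard : ℝ≥0∞) := ENat.toENNReal_le.2 hnC.le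
    exact absurd ((h3.trans this).trans_lt hn) (by simp)
  have hfin : (maximalSeparatedSet ε F).Finite := by
    rw [← Set.encard_ne_top_iff, encard_maximalSeparatedSet htop]
    exact htop
  refine ⟨hfin.toFinset, by simpa using isCover_maximalSeparatedSet htop, ?_⟩
  have := hsep _ maximalSeparatedSet_subset isSeparated_maximalSeparatedSet
  rw [hfin.encard_eq_coe_toFinset_card, ENat.toENNReal_coe] at this
  have h4 := ENNReal.toReal_mono (measure_ne_top _ _) this
  rw [ENNReal.toReal_mul, ENNReal.toReal_natCast, ENNReal.toReal_ofReal hb.le] at h4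
  rw [Real.rpow_neg hεr.le, ← div_eq_mul_inv, le_div_iff₀ (Real.rpow_pos_of_pos hεr u),
    div_mul_eq_mul_div, le_div_iff₀ hκ]
  rw [Real.div_rpow hεr.le (by norm_num)] at h4
  have h5 : (0 : ℝ) < 2 ^ u := by positivity
  calc (hfin.toFinset.card : ℝ) * (ε : ℝ) ^ u * κ
      = hfin.toFinset.card * (κ * ((ε : ℝ) ^ u / 2 ^ u)) * 2 ^ u := by field_simp
    _ ≤ m.real Set.univ * 2 ^ u := by gcongr; exact h4

theorem externalCoveringNumber_le_of_le_measure_closedBall (hκ : 0 < κ)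
    (h : ∀ x ∈ F, ∀ r : ℝ, 0 < r → r < 1 → ENNReal.ofReal (κ * r ^ u) ≤ m (closedBall x r))
    {ε : ℝ≥0} (hε : 0 < ε) (hε1 : ε < 1) :
    (externalCoveringNumber ε F : ℝ≥0∞)
      ≤ ENNReal.ofReal (m.real Set.univ / κ * 2 ^ u * (ε : ℝ) ^ (-u)) := by
  obtain ⟨C, hC, hcard⟩ := exists_finset_isCover hκ h hε hε1
  refine (ENat.toENNReal_le.2 hC.externalCoveringNumber_le_encard).trans ?_
  rw [Set.encard_coe_eq_coe_finsetCard, ENat.toENNReal_coe, ← ENNReal.ofReal_natCast]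
  exact ENNReal.ofReal_le_ofReal hcard

/-- Nets made of `O(ε^{-u})` points give coverings by balls of radius `ε` with bounded
`u`-dimensional sums. -/
theorem dimH_le_of_le_measure_closedBall (hκ : 0 < κ) (hu : 0 ≤ u)
    (h : ∀ x ∈ F, ∀ r : ℝ, 0 < r → r < 1 → ENNReal.ofReal (κ * r ^ u) ≤ m (closedBall x r)) :
    dimH F ≤ ENNReal.ofReal u := by
  set K := m.real Set.univ / κ * 2 ^ u
  have hex : ∀ n : ℕ, ∃ C : Finset X, IsCover (1 / ((n : ℝ≥0) + 2)) F (C : Set X) ∧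
      (C.card : ℝ) ≤ K * ((1 / ((n : ℝ≥0) + 2) : ℝ≥0) : ℝ) ^ (-u) := fun n =>
    exists_finset_isCover hκ h (by positivity) (by
      rw [div_lt_one (by positivity)]
      exact lt_of_lt_of_le one_lt_two (by simp))
  choose C hC hcard using hex
  have hdiam : ∀ (n : ℕ) (i : C n), ediam (closedBall i.1 ((1 / ((n : ℝ≥0) + 2) : ℝ≥0) : ℝ))
      ≤ ENNReal.ofReal (2 * (1 / ((n : ℝ≥0) + 2) : ℝ≥0)) := by
    intro n i
    refine ediam_le_of_forall_dist_le fun y hy z hz => ?_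
    have := dist_triangle_right y z i.1
    simp only [mem_closedBall] at hy hz
    linarith
  rw [ENNReal.ofReal]
  refine dimH_le_of_hausdorffMeasure_ne_top (ne_of_lt ?_)
  rw [Real.coe_toNNReal u hu]
  refine lt_of_le_of_lt (Measure.hausdorffMeasure_le_liminf_sum u F (l := atTop)
    (fun n : ℕ => ENNReal.ofReal (2 * (1 / ((n : ℝ≥0) + 2) : ℝ≥0))) ?_
    (fun n (i : C n) => closedBall i.1 ((1 / ((n : ℝ≥0) + 2) : ℝ≥0) : ℝ))
    (Eventually.of_forall hdiam) (Eventually.of_forall fun n => ?_)) ?_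
  · have hlim : Tendsto (fun n : ℕ => 2 * (1 / ((n : ℝ) + 2))) atTop (𝓝 (2 * 0)) := by
      refine Tendsto.const_mul 2 ?_
      have := (tendsto_one_div_add_atTop_nhds_zero_nat (𝕜 := ℝ)).comp (tendsto_add_atTop_nat 1)
      refine this.congr fun n => ?_
      simp only [Function.comp_apply]
      push_cast
      ring
    have := ENNReal.tendsto_ofReal hlim
    simpa using this
  · refine (hC n).subset_iUnion_closedBall.trans fun x hx => ?_
    simp only [Set.mem_iUnion] at hx ⊢
    obtain ⟨y, hy, hxy⟩ := hx
    exact ⟨⟨y, hy⟩, hxy⟩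
  · refine lt_of_le_of_lt (b := ENNReal.ofReal (K * 2 ^ u)) ?_ ENNReal.ofReal_lt_top
    refine liminf_le_of_le (by isBoundedDefault) fun b hb => ?_
    obtain ⟨n, hn⟩ := hb.exists
    refine hn.trans ?_
    set e : ℝ≥0 := 1 / ((n : ℝ≥0) + 2)
    have he : 0 < (e : ℝ) := by positivity
    calc ∑ i : C n, ediam (closedBall i.1 (e : ℝ)) ^ u
        ≤ ∑ i : C n, ENNReal.ofReal ((2 * e) ^ u) := by
          refine Finset.sum_le_sum fun i _ => ?_
          rw [← ENNReal.ofReal_rpow_of_nonneg (by positivity) hu]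
          exact ENNReal.rpow_le_rpow (hdiam n i) hu
      _ = ENNReal.ofReal ((C n).card * (2 * e) ^ u) := by
          rw [Finset.sum_const, Finset.card_univ, Fintype.card_coe, nsmul_eq_mul,
            ENNReal.ofReal_mul (Nat.cast_nonneg _), ENNReal.ofReal_natCast]
      _ ≤ ENNReal.ofReal (K * 2 ^ u) := by
          refine ENNReal.ofReal_le_ofReal ?_
          calc ((C n).card : ℝ) * (2 * e) ^ u ≤ K * (e : ℝ) ^ (-u) * (2 * e) ^ u := by
                gcongr
                exact hcard n
            _ = K * 2 ^ u * ((e : ℝ) ^ (-u) * (e : ℝ) ^ u) := by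
                rw [Real.mul_rpow (by norm_num) he.le]
                ring
            _ = K * 2 ^ u := by
                rw [← Real.rpow_add he, neg_add_cancel, Real.rpow_zero, mul_one]

/-- The masses of the disjoint balls of a packing dominate the `u`-th powers of their diameters, so
a single countable cover, `F` itself, shows that the packing measure is finite. -/
theorem packingMeasure_ne_top_of_le_measure_closedBall (hκ : 0 < κ) (hu : 0 ≤ u)
    (h : ∀ x ∈ F, ∀ r : ℝ, 0 < r → r < 1 → ENNReal.ofReal (κ * r ^ u) ≤ m (closedBall x r)) :
    packingMeasure u F ≠ ∞ := by
  have hpre : packingPremeasure u F ≤ ENNReal.ofReal (2 ^ u / κ) * m Set.univ := by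
    refine iInf₂_le_of_le (1 / 2) (by norm_num) (iSup₂_le fun B hB => ?_)
    calc ∑' p : B, ediam (closedBall p.1.1 p.1.2) ^ u
        ≤ ∑' p : B, ENNReal.ofReal (2 ^ u / κ) * m (closedBall p.1.1 p.1.2) := by
          refine ENNReal.tsum_le_tsum fun p => ?_
          obtain ⟨hpF, hp0, hp1⟩ := hB.1 p.1 p.2
          have hd : ediam (closedBall p.1.1 p.1.2) ≤ ENNReal.ofReal (2 * p.1.2) := by
            refine ediam_le_of_forall_dist_le fun y hy z hz => ?_
            have := dist_triangle_right y z p.1.1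
            simp only [mem_closedBall] at hy hz
            linarith
          refine (ENNReal.rpow_le_rpow hd hu).trans ?_
          refine le_trans (le_of_eq ?_)
            (mul_le_mul_right (h p.1.1 hpF p.1.2 hp0 (by linarith)) _)
          rw [ENNReal.ofReal_rpow_of_nonneg (by positivity) hu,
            ← ENNReal.ofReal_mul (by positivity), Real.mul_rpow (by norm_num) hp0.le]
          congr 1
          field_simp
      _ = ENNReal.ofReal (2 ^ u / κ) * ∑' p : B, m (closedBall p.1.1 p.1.2) :=
          ENNReal.tsum_mul_left
      _ ≤ ENNReal.ofReal (2 ^ u / κ) * m Set.univ := by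
          gcongr
          refine (tsum_meas_le_meas_iUnion_of_disjoint m
            (fun _ => isClosed_closedBall.measurableSet) fun p p' hp => ?_).trans
            (measure_mono (Set.subset_univ _))
          exact hB.2 p.2 p'.2 fun e => hp (Subtype.ext e)
  refine ne_of_lt (lt_of_le_of_lt (b := packingPremeasure u F) ?_ (hpre.trans_lt
    (ENNReal.mul_lt_top ENNReal.ofReal_lt_top (measure_lt_top _ _))))
  refine iInf₂_le_of_le (fun n : ℕ => if n = 0 then F else ∅)
    (fun x hx => Set.mem_iUnion.2 ⟨0, by simpa using hx⟩) ?_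
  rw [tsum_eq_single 0 fun n hn => by simp [hn, packingPremeasure_empty]]
  simp

end LargeBalls

/-! ### Lower bounds on dimensions from measures with small balls -/

section SmallBalls

variable {X : Type*} [MetricSpace X] [MeasurableSpace X] {F : Set X} {m : Measure X} {K u : ℝ}

/-- The mass distribution principle. -/
theorem le_dimH_of_measure_ball_le [BorelSpace X] (hK : 0 < K) (hu : 0 < u)
    (h : ∀ x ∈ F, ∀ r : ℝ, 0 < r → r < 1 → m (ball x r) ≤ ENNReal.ofReal (K * r ^ u))
    (hmF : m Fᶜ = 0) (hm : m F ≠ 0) : ENNReal.ofReal u ≤ dimH F := by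
  have hKe : ENNReal.ofReal K ≠ 0 := (ENNReal.ofReal_pos.2 hK).ne'
  have hle : (ENNReal.ofReal K)⁻¹ • m ≤ μH[u] := by
    refine Measure.le_hausdorffMeasure u _ (ENNReal.ofReal (1 / 2)) (by norm_num) fun S hS => ?_
    rw [Measure.smul_apply, smul_eq_mul]
    by_cases hne : (S ∩ F).Nonempty
    · obtain ⟨x, hxS, hxF⟩ := hne
      have hfin : ediam S ≠ ∞ := (hS.trans_lt ENNReal.ofReal_lt_top).ne
      have hd : diam S ≤ 1 / 2 := ENNReal.toReal_le_of_le_ofReal (by norm_num) hS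
      have hd0 : 0 ≤ diam S := diam_nonneg
      have hball : ∀ r, diam S < r → S ⊆ ball x r := fun r hr y hy =>
        (dist_le_diam_of_mem' hfin hy hxS).trans_lt hr
      have hlim : m S ≤ ENNReal.ofReal (K * diam S ^ u) := by
        refine ge_of_tendsto (f := fun r : ℝ => ENNReal.ofReal (K * r ^ u)) (x := 𝓝[>] (diam S))
          ?_ ?_
        · refine ENNReal.tendsto_ofReal (Tendsto.const_mul K ?_)
          exact ((Real.continuousAt_rpow_const _ _ (.inr hu.le)).tendsto).mono_left
            nhdsWithin_le_nhds
        · filter_upwards [Ioo_mem_nhdsGT (show diam S < 1 by linarith)] with r hr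
          exact (measure_mono (hball r hr.1)).trans (h x hxF r (hd0.trans_lt hr.1) hr.2)
      calc (ENNReal.ofReal K)⁻¹ * m S
          ≤ (ENNReal.ofReal K)⁻¹ * ENNReal.ofReal (K * diam S ^ u) := by gcongr
        _ = ENNReal.ofReal (diam S) ^ u := by
          rw [ENNReal.ofReal_mul hK.le, ← mul_assoc,
            ENNReal.inv_mul_cancel hKe ENNReal.ofReal_ne_top, one_mul,
            ENNReal.ofReal_rpow_of_nonneg hd0 hu.le]
        _ = ediam S ^ u := by rw [diam, ENNReal.ofReal_toReal hfin]
    · have : m S = 0 := by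
        refine measure_mono_null (fun y hy hyF => hne ⟨y, hy, hyF⟩) hmF
      simp [this]
  rw [ENNReal.ofReal]
  refine le_dimH_of_hausdorffMeasure_ne_zero ?_
  rw [Real.coe_toNNReal u hu.le]
  intro h0
  have := hle F
  rw [h0, Measure.smul_apply, smul_eq_mul, nonpos_iff_eq_zero, mul_eq_zero] at this
  exact this.elim (ENNReal.inv_ne_zero.2 ENNReal.ofReal_ne_top) hm

/-- Every ball of radius `ε`, wherever centred, that meets `F` lies in a ball of radius `3ε` about a
point of `F`. -/
theorem measure_le_encard_mul (hK : 0 < K)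
    (h : ∀ x ∈ F, ∀ r : ℝ, 0 < r → r < 1 → m (ball x r) ≤ ENNReal.ofReal (K * r ^ u))
    {A C : Set X} (hA : A ⊆ F) {ε : ℝ≥0} (hε : 0 < ε) (hε1 : (ε : ℝ) < 1 / 3)
    (hC : IsCover ε A C) :
    m A ≤ C.encard * ENNReal.ofReal (K * (3 * ε) ^ u) := by
  have hεr : 0 < (ε : ℝ) := hε
  have hpos : 0 < ENNReal.ofReal (K * (3 * ε) ^ u) := ENNReal.ofReal_pos.2 (by positivity)
  rcases C.finite_or_infinite with hfin | hinf
  · have hsub : A ⊆ ⋃ y ∈ hfin.toFinset, A ∩ closedBall y (ε : ℝ) := by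
      intro x hx
      have := hC.subset_iUnion_closedBall hx
      simp only [Set.mem_iUnion, Set.Finite.mem_toFinset, Set.mem_inter_iff] at this ⊢
      obtain ⟨y, hy, hxy⟩ := this
      exact ⟨y, hy, hx, hxy⟩
    refine (measure_mono hsub).trans ((measure_biUnion_finset_le _ _).trans ?_)
    rw [hfin.encard_eq_coe_toFinset_card, ENat.toENNReal_coe, ← nsmul_eq_mul]
    refine Finset.sum_le_card_nsmul _ _ _ fun y _ => ?_
    rcases (A ∩ closedBall y (ε : ℝ)).eq_empty_or_nonempty with he | ⟨x, hxA, hxy⟩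
    · simp [he]
    · refine le_trans (measure_mono fun z hz => ?_)
        (h x (hA hxA) (3 * ε) (by positivity) (by linarith))
      have h1 := dist_triangle_right z x y
      have h2 : dist z y ≤ ε := hz.2
      have h3 : dist x y ≤ ε := hxy
      rw [mem_ball]
      linarith
  · rw [hinf.encard_eq]
    simp [ENNReal.top_mul hpos.ne']

/-- The balls of radius `δ` about a maximal `2δ`-separated subset of `A` form a packing of at least
`const · δ^{-u}` balls, whose `v`-dimensional sum is of order `δ^{v - u}` and so is unbounded as
`δ → 0`.  The hypothesis on `X` excludes spaces in which balls have too small a diameter. -/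
theorem packingPremeasure_eq_top (hX : ∀ (x : X) (r : ℝ), 0 ≤ r →
      ENNReal.ofReal r ≤ ediam (closedBall x r)) (hK : 0 < K) {v : ℝ} (hv : 0 ≤ v) (hvu : v < u)
    (h : ∀ x ∈ F, ∀ r : ℝ, 0 < r → r < 1 → m (ball x r) ≤ ENNReal.ofReal (K * r ^ u))
    {A : Set X} (hA : A ⊆ F) (hmA : m A ≠ 0) : packingPremeasure v A = ∞ := by
  simp only [packingPremeasure, iInf_eq_top]
  intro ε hε
  by_contra hS
  set S := packingSum v ε A
  have key : ∀ δ : ℝ≥0, 0 < δ → (δ : ℝ) < 1 / 6 → (δ : ℝ) ≤ ε →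
      m A ≤ ENNReal.ofReal (K * 6 ^ u * (δ : ℝ) ^ (u - v)) * S := by
    intro δ hδ hδ6 hδε
    have hδr : 0 < (δ : ℝ) := hδ
    obtain ⟨C, hC⟩ := exists_maximal_isSeparated (2 * δ) A
    have hcov := IsCover.of_maximal_isSeparated hC
    have hm := measure_le_encard_mul hK h hA (ε := 2 * δ) (by positivity)
      (by push_cast; linarith) hcov
    have hpack : (C.encard : ℝ≥0∞) * ENNReal.ofReal ((δ : ℝ) ^ v) ≤ S := by
      have hinj : Function.Injective fun x : X => (x, (δ : ℝ)) := fun x y e => congrArg Prod.fst e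
      have hB : IsPacking ε A ((fun x : X => (x, (δ : ℝ))) '' C) := by
        refine ⟨?_, ?_⟩
        · rintro _ ⟨x, hx, rfl⟩
          exact ⟨hC.1.1 hx, hδr, hδε⟩
        · rintro _ ⟨x, hx, rfl⟩ _ ⟨y, hy, rfl⟩ hxy
          exact disjoint_closedBall_of_isSeparated hC.1.2 hx hy fun (e : x = y) => hxy (by rw [e])
      refine le_trans ?_ (le_iSup₂_of_le _ hB le_rfl)
      rw [← hinj.encard_image, ← ENNReal.tsum_set_const]
      refine ENNReal.tsum_le_tsum ?_
      rintro ⟨_, x, hx, rfl⟩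
      rw [← ENNReal.ofReal_rpow_of_nonneg hδr.le hv]
      exact ENNReal.rpow_le_rpow (hX x δ hδr.le) hv
    have hsplit : K * (3 * ((2 * δ : ℝ≥0) : ℝ)) ^ u
        = (K * 6 ^ u * (δ : ℝ) ^ (u - v)) * (δ : ℝ) ^ v := by
      rw [mul_assoc (K * 6 ^ u), ← Real.rpow_add hδr, sub_add_cancel, mul_assoc,
        ← Real.mul_rpow (by norm_num) hδr.le]
      push_cast
      ring_nf
    rw [hsplit, ENNReal.ofReal_mul (by positivity), mul_left_comm] at hm
    exact hm.trans (by gcongr)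
  have hlim : Tendsto (fun δ : ℝ≥0 => ENNReal.ofReal (K * 6 ^ u * (δ : ℝ) ^ (u - v)) * S)
      (𝓝[>] 0) (𝓝 (ENNReal.ofReal (K * 6 ^ u * 0) * S)) := by
    refine ENNReal.Tendsto.mul_const (ENNReal.tendsto_ofReal (Tendsto.const_mul _ ?_)) (.inr hS)
    have h1 : Tendsto (fun δ : ℝ≥0 => (δ : ℝ)) (𝓝[>] 0) (𝓝 0) :=
      (NNReal.continuous_coe.tendsto' 0 0 rfl).mono_left nhdsWithin_le_nhds
    have := h1.rpow_const (p := u - v) (.inr (by linarith))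
    rwa [Real.zero_rpow (by linarith)] at this
  rw [mul_zero, ENNReal.ofReal_zero, zero_mul] at hlim
  refine hmA (le_antisymm (ge_of_tendsto hlim ?_) bot_le)
  have hpos : (0 : ℝ≥0) < min (1 / 7) ⟨ε, hε.le⟩ := lt_min (by positivity) hε
  filter_upwards [Ioo_mem_nhdsGT hpos] with δ hδ
  have h1 : (δ : ℝ) < (1 / 7 : ℝ≥0) := (hδ.2.trans_le (min_le_left _ _))
  have h2 : (δ : ℝ) < ε := (hδ.2.trans_le (min_le_right _ _))
  refine key δ hδ.1 ?_ h2.le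
  push_cast at h1
  linarith

theorem packingMeasure_eq_top (hX : ∀ (x : X) (r : ℝ), 0 ≤ r →
      ENNReal.ofReal r ≤ ediam (closedBall x r)) (hK : 0 < K) {v : ℝ} (hv : 0 ≤ v) (hvu : v < u)
    (h : ∀ x ∈ F, ∀ r : ℝ, 0 < r → r < 1 → m (ball x r) ≤ ENNReal.ofReal (K * r ^ u))
    (hm : m F ≠ 0) : packingMeasure v F = ∞ := by
  simp only [packingMeasure, iInf_eq_top]
  intro G hG
  have : ∃ i, m (F ∩ G i) ≠ 0 := by
    by_contra! h0
    refine hm (measure_mono_null (fun x hx => ?_) (measure_iUnion_null h0))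
    obtain ⟨i, hi⟩ := Set.mem_iUnion.1 (hG hx)
    exact Set.mem_iUnion.2 ⟨i, hx, hi⟩
  obtain ⟨i, hi⟩ := this
  refine ENNReal.tsum_eq_top_of_eq_top ⟨i, top_le_iff.1 ?_⟩
  rw [← packingPremeasure_eq_top hX hK hv hvu h Set.inter_subset_left hi]
  exact packingPremeasure_mono v Set.inter_subset_right

theorem le_externalCoveringNumber_of_measure_ball_le [IsFiniteMeasure m] (hK : 0 < K)
    (h : ∀ x ∈ F, ∀ r : ℝ, 0 < r → r < 1 → m (ball x r) ≤ ENNReal.ofReal (K * r ^ u))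
    {ε : ℝ≥0} (hε : 0 < ε) (hε1 : (ε : ℝ) < 1 / 3) :
    ENNReal.ofReal (m.real F / (K * 3 ^ u) * (ε : ℝ) ^ (-u))
      ≤ (externalCoveringNumber ε F : ℝ≥0∞) := by
  have hεr : 0 < (ε : ℝ) := hε
  have hpos : 0 < K * (3 * (ε : ℝ)) ^ u := by positivity
  have hC : ∀ C, IsCover ε F C →
      ENNReal.ofReal (m.real F / (K * 3 ^ u) * (ε : ℝ) ^ (-u)) ≤ (C.encard : ℝ≥0∞) := by
    intro C hC
    have h1 := measure_le_encard_mul hK h subset_rfl hε hε1 hC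
    rw [← ENNReal.div_le_iff_le_mul (.inl (ENNReal.ofReal_pos.2 hpos).ne')
      (.inl ENNReal.ofReal_ne_top), ← ENNReal.ofReal_toReal (measure_ne_top m F),
      ← ENNReal.ofReal_div_of_pos hpos] at h1
    convert h1 using 2
    rw [Real.mul_rpow (by norm_num) hεr.le, Real.rpow_neg hεr.le]
    simp only [Measure.real]
    field_simp
  -- The covering number is an infimum in `ℕ∞`, hence attained when finite.
  rcases eq_or_ne (externalCoveringNumber ε F) ⊤ with ht | ht
  · simp [ht]
  · have hlt : externalCoveringNumber ε F < externalCoveringNumber ε F + 1 :=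
      ENat.lt_add_one_iff ht |>.2 le_rfl
    conv_lhs at hlt => rw [externalCoveringNumber]
    simp only [iInf_lt_iff] at hlt
    obtain ⟨C, hCc, hlt⟩ := hlt
    refine (hC C hCc).trans (ENat.toENNReal_le.2 ?_)
    exact (ENat.lt_add_one_iff ht).1 hlt

end SmallBalls

/-! ### The box dimension and power laws for covering numbers -/

section Box

variable {X : Type*} [MetricSpace X] {F : Set X} {K u w : ℝ}

theorem tendsto_coe_nhdsGT_zero : Tendsto (fun ε : ℝ≥0 => (ε : ℝ)) (𝓝[>] 0) (𝓝[>] 0) :=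
  tendsto_nhdsWithin_iff.2 ⟨(NNReal.continuous_coe.tendsto' 0 0 rfl).mono_left nhdsWithin_le_nhds,
    eventually_mem_nhdsWithin⟩

theorem tendsto_mul_rpow_nhdsGT_zero (hu : 0 < u) :
    Tendsto (fun ε : ℝ≥0 => K * (ε : ℝ) ^ u) (𝓝[>] 0) (𝓝 0) := by
  have := ((tendsto_nhdsWithin_iff.1 tendsto_coe_nhdsGT_zero).1.rpow_const
    (p := u) (.inr hu.le)).const_mul K
  rwa [Real.zero_rpow hu.ne', mul_zero] at this

theorem log_one_div_pos {ε : ℝ≥0} (h0 : 0 < ε) (h1 : ε < 1) :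
    (0 : EReal) < ((Real.log (1 / (ε : ℝ)) : ℝ) : EReal) :=
  EReal.coe_pos.2 (Real.log_pos (by rw [lt_div_iff₀ (by exact h0), one_mul]; exact h1))

theorem log_ofReal_rpow_neg {ε : ℝ≥0} (h0 : 0 < ε) :
    ENNReal.log (ENNReal.ofReal ((ε : ℝ) ^ (-w)))
      = ((Real.log (1 / (ε : ℝ)) : ℝ) : EReal) * (w : EReal) := by
  have h0' : 0 < (ε : ℝ) := h0
  rw [ENNReal.log_ofReal_of_pos (by positivity), ← EReal.coe_mul, Real.log_rpow h0',
    one_div, Real.log_inv]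
  congr 1
  ring

theorem upperBoxDim_le_of_externalCoveringNumber_le (huw : u < w)
    (h : ∀ᶠ ε : ℝ≥0 in 𝓝[>] 0,
      (externalCoveringNumber ε F : ℝ≥0∞) ≤ ENNReal.ofReal (K * (ε : ℝ) ^ (-u))) :
    upperBoxDim F ≤ (w : EReal) := by
  refine limsup_le_of_le (by isBoundedDefault) ?_
  filter_upwards [h, Ioo_mem_nhdsGT one_pos,
    (tendsto_mul_rpow_nhdsGT_zero (K := K) (sub_pos.2 huw)).eventually_lt_const one_pos]
    with ε hε hε1 hK
  have h0 : 0 < (ε : ℝ) := hε1.1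
  rw [EReal.div_le_iff_le_mul (log_one_div_pos hε1.1 hε1.2) (EReal.coe_ne_top _),
    ← log_ofReal_rpow_neg hε1.1]
  refine ENNReal.log_le_log (hε.trans (ENNReal.ofReal_le_ofReal ?_))
  calc K * (ε : ℝ) ^ (-u) = K * (ε : ℝ) ^ (w - u) * (ε : ℝ) ^ (-w) := by
        rw [mul_assoc, ← Real.rpow_add h0]
        ring_nf
    _ ≤ 1 * (ε : ℝ) ^ (-w) := by gcongr
    _ = _ := one_mul _

theorem le_upperBoxDim_of_le_externalCoveringNumber (hK : 0 < K) (hwu : w < u)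
    (h : ∀ᶠ ε : ℝ≥0 in 𝓝[>] 0,
      ENNReal.ofReal (K * (ε : ℝ) ^ (-u)) ≤ (externalCoveringNumber ε F : ℝ≥0∞)) :
    (w : EReal) ≤ upperBoxDim F := by
  refine le_limsup_of_frequently_le (Eventually.frequently ?_)
  filter_upwards [h, Ioo_mem_nhdsGT one_pos,
    (tendsto_mul_rpow_nhdsGT_zero (K := K⁻¹) (sub_pos.2 hwu)).eventually_lt_const one_pos]
    with ε hε hε1 hK1
  have h0 : 0 < (ε : ℝ) := hε1.1
  rw [EReal.le_div_iff_mul_le (log_one_div_pos hε1.1 hε1.2) (EReal.coe_ne_top _), mul_comm,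
    ← log_ofReal_rpow_neg hε1.1]
  refine ENNReal.log_le_log (le_trans (ENNReal.ofReal_le_ofReal ?_) hε)
  calc (ε : ℝ) ^ (-w) = K * (K⁻¹ * (ε : ℝ) ^ (u - w)) * (ε : ℝ) ^ (-u) := by
        rw [← mul_assoc, mul_inv_cancel₀ hK.ne', one_mul, ← Real.rpow_add h0]
        ring_nf
    _ ≤ K * 1 * (ε : ℝ) ^ (-u) := by gcongr
    _ = _ := by rw [mul_one]

theorem upperBoxDim_nonneg (hF : F.Nonempty) : 0 ≤ upperBoxDim F := by
  refine le_limsup_of_frequently_le (Eventually.frequently ?_)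
  filter_upwards [Ioo_mem_nhdsGT (one_pos : (0 : ℝ≥0) < 1)] with ε hε
  refine EReal.div_nonneg (ENNReal.zero_le_log_iff.2 ?_) (log_one_div_pos hε.1 hε.2).le
  rw [← ENat.toENNReal_one, ENat.toENNReal_le, Order.one_le_iff_pos]
  exact externalCoveringNumber_pos_iff.2 hF

end Box

/-! ### Coding of the limit set -/

section Coding

variable {q : ℕ} {X : Type*} [MetricSpace X] {Δ : ∀ k : ℕ, (Fin k → Fin q) → Set X}
  {c : ℕ → Fin q → ℝ}

/-- Weak separation makes the words whose basic sets contain a given point of the limit set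
compatible, so that the point is coded by an infinite word. -/
theorem exists_coding (hΔ : IsMoranConstruction Δ) {x : X} (hx : x ∈ limitSet Δ) :
    ∃ ω : ℕ → Fin q, ∀ k, x ∈ Δ k fun j => ω j := by
  have hx' : ∀ k, ∃ w : Fin k → Fin q, x ∈ Δ k w := fun k =>
    Set.mem_iUnion.1 (Set.mem_iInter.1 hx k)
  choose w hw using hx'
  have hinit : ∀ k, Fin.init (w (k + 1)) = w k := by
    intro k
    by_contra hne
    have : x ∈ Δ k (Fin.init (w (k + 1))) ∩ Δ k (w k) ∩ limitSet Δ :=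
      ⟨⟨hΔ.nested k _ (hw (k + 1)), hw k⟩, hx⟩
    rw [hΔ.separated k _ _ hne] at this
    exact this
  refine ⟨fun k => w (k + 1) (Fin.last k), fun k => ?_⟩
  have heq : w k = fun j : Fin k => w (j + 1) (Fin.last j) := by
    induction k with
    | zero => exact Subsingleton.elim _ _
    | succ k ih =>
      funext j
      induction j using Fin.lastCases with
      | last => rfl
      | cast j =>
        have h1 : w (k + 1) j.castSucc = w k j := congrFun (hinit k) j
        rw [h1, ih]
        rfl
  rw [← heq]
  exact hw k

theorem weight_coding_succ (ω : ℕ → Fin q) (k : ℕ) :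
    weight c (fun j : Fin (k + 1) => ω j) = weight c (fun j : Fin k => ω j) * c k (ω k) := by
  simp [weight, Fin.prod_univ_castSucc]

theorem exists_weight_le_pow [NeZero q] (hb : IsBasic c) (hc : ∀ k i, 0 < c k i) :
    ∃ b : ℝ, 0 < b ∧ b < 1 ∧ ∀ (k : ℕ) (w : Fin k → Fin q), weight c w ≤ b ^ k := by
  obtain ⟨b, hb1, hb⟩ := hb
  refine ⟨b, (hc 0 0).trans_le (hb 0 0), hb1, fun k w => ?_⟩
  calc weight c w ≤ ∏ _j : Fin k, b :=
        Finset.prod_le_prod (fun j _ => (hc _ _).le) fun j _ => hb _ _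
    _ = b ^ k := by simp

/-- Appending a letter multiplies a weight at worst by a small power of it: the contraction numbers
decay subexponentially in the length of the word, and the weights exponentially. -/
theorem exists_mul_weight_rpow_le [NeZero q] {s : ℝ} (hcrit : IsCritical c s) (hb : IsBasic c)
    {η : ℝ} (hη : 0 < η) :
    ∃ ρ : ℝ, 0 < ρ ∧ ∀ (k : ℕ) (w : Fin k → Fin q) (i : Fin q),
      ρ * weight c w ^ (1 + η) ≤ weight c w * c k i := by
  obtain ⟨b, hb0, hb1, hb⟩ := exists_weight_le_pow hb hcrit.pos
  obtain ⟨ρ, hρ, hsub⟩ := hcrit.subexp (η * -Real.log b)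
    (mul_pos hη (neg_pos.2 (Real.log_neg hb0 hb1)))
  refine ⟨ρ, hρ, fun k w i => ?_⟩
  have hw := weight_pos hcrit.pos w
  rw [Real.rpow_add hw, Real.rpow_one, mul_left_comm]
  refine mul_le_mul_of_nonneg_left (le_trans ?_ (hsub k i)) hw.le
  refine mul_le_mul_of_nonneg_left ?_ hρ.le
  calc weight c w ^ η ≤ (b ^ k) ^ η := Real.rpow_le_rpow hw.le (hb k w) hη.le
    _ = Real.exp (-(η * -Real.log b * k)) := by
      rw [Real.rpow_def_of_pos (by positivity), Real.log_pow]
      ring_nf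

theorem exists_weight_coding_le [NeZero q] (hb : IsBasic c) (hc : ∀ k i, 0 < c k i)
    (ω : ℕ → Fin q) {r : ℝ} (hr : 0 < r) : ∃ k, weight c (fun j : Fin k => ω j) ≤ r := by
  obtain ⟨b, hb0, hb1, hb⟩ := exists_weight_le_pow hb hc
  obtain ⟨k, hk⟩ := exists_pow_lt_of_lt_one hr hb1
  exact ⟨k, (hb k _).trans hk.le⟩

/-- Along a coding the weights cross every level `r < 1` in one step. -/
theorem exists_lt_weight_coding [NeZero q] (hb : IsBasic c) (hc : ∀ k i, 0 < c k i)
    (ω : ℕ → Fin q) {r : ℝ} (hr : 0 < r) (hr1 : r < 1) :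
    ∃ k, r < weight c (fun j : Fin k => ω j) ∧ weight c (fun j : Fin (k + 1) => ω j) ≤ r := by
  classical
  have hex := exists_weight_coding_le hb hc ω hr
  obtain ⟨k, hk⟩ : ∃ k, Nat.find hex = k + 1 := by
    refine Nat.exists_eq_succ_of_ne_zero fun h0 => ?_
    have := Nat.find_spec hex
    rw [h0] at this
    simp only [weight, Finset.univ_eq_empty, Finset.prod_empty] at this
    linarith
  refine ⟨k, not_le.1 (Nat.find_min hex (by omega)), ?_⟩
  have := Nat.find_spec hex
  rwa [hk] at this

theorem exists_isMoranWord_coding [NeZero q] (hb : IsBasic c) (hc : ∀ k i, 0 < c k i)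
    (ω : ℕ → Fin q) {r : ℝ} (hr : 0 < r) (hr1 : r < 1) :
    ∃ k, IsMoranWord c r fun j : Fin k => ω j := by
  classical
  have hex : ∃ k, IsStop c r fun j : Fin k => ω j := by
    obtain ⟨k, hk, hk1⟩ := exists_lt_weight_coding hb hc ω hr hr1
    refine ⟨k, hk, ω k, ?_⟩
    rwa [weight_snoc, ← weight_coding_succ]
  exact ⟨Nat.find hex, Nat.find_spec hex, fun l hl => Nat.find_min hex hl⟩

theorem limitSet_nonempty [NeZero q] (hΔ : IsMoranConstruction Δ) : (limitSet Δ).Nonempty := by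
  refine IsCompact.nonempty_iInter_of_sequence_nonempty_isCompact_isClosed
    (fun k => ⋃ ω : Fin k → Fin q, Δ k ω) (fun k => ?_) (fun k => ?_) ?_ (fun k => ?_)
  · exact Set.iUnion_subset fun ω => (hΔ.nested k ω).trans (Set.subset_iUnion _ _)
  · exact (hΔ.nonempty k fun _ => 0).mono (Set.subset_iUnion (Δ k) _)
  · exact isCompact_iUnion fun ω => hΔ.isCompact 0 ω
  · exact (isCompact_iUnion fun ω => hΔ.isCompact k ω).isClosed

end Coding

/-! ### Gibbs-like measures on balls -/

section Gibbs

variable {q : ℕ}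

theorem measure_univ_lt_top_of_basic_sets {X : Type*} [MeasurableSpace X]
    {Δ : ∀ k : ℕ, (Fin k → Fin q) → Set X} {m : Measure X} (hm : m (limitSet Δ)ᶜ = 0)
    (h : ∀ ω : Fin 1 → Fin q, m (Δ 1 ω) < ∞) : m Set.univ < ∞ := by
  rw [← Set.union_compl_self (limitSet Δ)]
  refine (measure_union_le _ _).trans_lt ?_
  rw [hm, add_zero]
  refine (measure_mono (Set.iInter_subset _ 1)).trans_lt ?_
  exact (measure_iUnion_le _).trans_lt (by simpa [ENNReal.sum_lt_top] using h)

variable [NeZero q] {X : Type*} [MetricSpace X] [MeasurableSpace X]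
  {Δ : ∀ k : ℕ, (Fin k → Fin q) → Set X} {c : ℕ → Fin q → ℝ} {s : ℝ}

/-- Above the critical exponent the partition sums are bounded, which makes balls large. -/
theorem exists_measure_le_closedBall (hΔ : IsMoranConstruction Δ) (hcrit : IsCritical c s)
    (hs : 0 ≤ s) (hb : IsBasic c) (hU : IsUpperEstimating Δ c) (hG : HasGibbsLikeMeasures Δ c)
    {u : ℝ} (hu : s < u) :
    ∃ (m : Measure X) (κ : ℝ), IsFiniteMeasure m ∧ 0 < κ ∧
      ∀ x ∈ limitSet Δ, ∀ r : ℝ, 0 < r → r < 1 →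
        ENNReal.ofReal (κ * r ^ u) ≤ m (closedBall x r) := by
  -- Half of the room between `s` and `u` bounds the partition sums, the other half absorbs the
  -- loss in passing from a word to its extension by one letter.
  set β := (s + u) / 2 with hβdef
  have hβs : s < β := by linarith
  have hβ : 0 < β := by linarith
  set η := u / β - 1 with hηdef
  have hη : 0 < η := by rw [sub_pos, lt_div_iff₀ hβ]; linarith
  have hηβ : (1 + η) * β = u := by rw [hηdef]; field_simp; ring
  obtain ⟨m, L, hL, hmF, hm⟩ := hG β hβ
  obtain ⟨ρ, hρ, hext⟩ := exists_mul_weight_rpow_le hcrit hb hη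
  obtain ⟨K, hK⟩ := hcrit.sum_le β hβs
  have hZ : ∀ k, 0 < ∑ ω : Fin k → Fin q, weight c ω ^ β := fun k =>
    Finset.sum_pos (fun ω _ => Real.rpow_pos_of_pos (weight_pos hcrit.pos ω) β)
      Finset.univ_nonempty
  have hK0 : 0 < K := (hZ 0).trans_le (hK 0)
  obtain ⟨C₀, -, hC₀⟩ := hU
  -- With `C ≥ 1` the level `r / C` is below the weight `1` of the empty word.
  set C := max C₀ 1
  have hC1 : 1 ≤ C := le_max_right _ _
  have hC0 : 0 < C := by linarith
  have hC : ∀ k (ω : Fin k → Fin q), diam (Δ k ω) ≤ C * weight c ω := fun k ω =>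
    (hC₀ k ω).trans (mul_le_mul_of_nonneg_right (le_max_left _ _) (weight_pos hcrit.pos ω).le)
  refine ⟨m, L⁻¹ * (ρ ^ β * C⁻¹ ^ u / K), ⟨measure_univ_lt_top_of_basic_sets hmF fun ω =>
    (hm 1 le_rfl ω).2.trans_lt ENNReal.ofReal_lt_top⟩, by positivity, fun x hx r hr hr1 => ?_⟩
  obtain ⟨ω, hω⟩ := exists_coding hΔ hx
  have hrC : r / C < 1 := (div_lt_one hC0).2 (hr1.trans_le hC1)
  obtain ⟨k, hk, hk1⟩ := exists_lt_weight_coding hb hcrit.pos ω (div_pos hr hC0) hrC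
  have hsub : Δ (k + 1) (fun j => ω j) ⊆ closedBall x r := by
    intro y hy
    refine (dist_le_diam_of_mem (hΔ.isCompact _ _).isBounded hy (hω (k + 1))).trans ?_
    refine (hC _ _).trans ?_
    rwa [le_div_iff₀' hC0] at hk1
  refine le_trans (ENNReal.ofReal_le_ofReal ?_)
    ((hm (k + 1) (by omega) fun j => ω j).1.trans (measure_mono hsub))
  have hw : ρ * (r / C) ^ (1 + η) ≤ weight c (fun j : Fin (k + 1) => ω j) := by
    rw [weight_coding_succ]
    refine le_trans ?_ (hext k _ _)
    gcongr
  have hwβ : ρ ^ β * C⁻¹ ^ u * r ^ u ≤ weight c (fun j : Fin (k + 1) => ω j) ^ β := by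
    have := Real.rpow_le_rpow (by positivity) hw hβ.le
    rw [Real.mul_rpow hρ.le (by positivity), ← Real.rpow_mul (by positivity), hηβ,
      div_eq_mul_inv, Real.mul_rpow hr.le (by positivity)] at this
    linarith
  calc L⁻¹ * (ρ ^ β * C⁻¹ ^ u / K) * r ^ u = L⁻¹ * (ρ ^ β * C⁻¹ ^ u * r ^ u / K) := by ring
    _ ≤ L⁻¹ * (weight c (fun j : Fin (k + 1) => ω j) ^ β / K) := by gcongr
    _ ≤ _ := by
      have := hZ (k + 1)
      have h2 := hK (k + 1)
      have h3 := Real.rpow_nonneg (weight_pos hcrit.pos fun j : Fin (k + 1) => ω j).le β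
      gcongr

/-- Below the critical exponent the partition sums are bounded away from zero, which makes balls
small: a ball is covered by boundedly many basic sets of the Moran covering. -/
theorem exists_measure_ball_le (hΔ : IsMoranConstruction Δ) (hcrit : IsCritical c s)
    (hb : IsBasic c) (hLE : IsLowerEstimating Δ c) (hG : HasGibbsLikeMeasures Δ c)
    {u : ℝ} (hu0 : 0 < u) (hu : u < s) :
    ∃ (m : Measure X) (K : ℝ), IsFiniteMeasure m ∧ 0 < K ∧ m (limitSet Δ)ᶜ = 0 ∧
      m (limitSet Δ) ≠ 0 ∧
      ∀ x ∈ limitSet Δ, ∀ r : ℝ, 0 < r → r < 1 → m (ball x r) ≤ ENNReal.ofReal (K * r ^ u) := by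
  set β := (u + s) / 2 with hβdef
  have hβs : β < s := by linarith
  have hβ : 0 < β := by linarith
  set η := β / u - 1 with hηdef
  have hη : 0 < η := by rw [sub_pos, lt_div_iff₀ hu0]; linarith
  have hηβ : (1 + η) * u = β := by rw [hηdef]; field_simp; ring
  obtain ⟨m, L, hL, hmF, hm⟩ := hG β hβ
  obtain ⟨ρ, hρ, hext⟩ := exists_mul_weight_rpow_le hcrit hb hη
  obtain ⟨κ, hκ, hZ⟩ := hcrit.le_sum β hβs
  have hfin : IsFiniteMeasure m := ⟨measure_univ_lt_top_of_basic_sets hmF fun ω =>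
    (hm 1 le_rfl ω).2.trans_lt ENNReal.ofReal_lt_top⟩
  set A := m.real Set.univ + L / κ
  have hA : 0 < A := add_pos_of_nonneg_of_pos measureReal_nonneg (div_pos hL hκ)
  have hcyl : ∀ k (w : Fin k → Fin q), m (Δ k w) ≤ ENNReal.ofReal (A * weight c w ^ β) := by
    intro k w
    have hw := Real.rpow_pos_of_pos (weight_pos hcrit.pos w) β
    -- The Gibbs bounds say nothing about the empty word, which may belong to a Moran covering.
    rcases Nat.eq_zero_or_pos k with rfl | hk
    · have h1 : weight c w = 1 := by simp [weight]
      rw [h1, Real.one_rpow, mul_one]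
      refine (measure_mono (Set.subset_univ _)).trans ?_
      rw [← ofReal_measureReal]
      exact ENNReal.ofReal_le_ofReal (le_add_of_nonneg_right (div_pos hL hκ).le)
    · refine (hm k hk w).2.trans (ENNReal.ofReal_le_ofReal ?_)
      calc L * (weight c w ^ β / ∑ ω' : Fin k → Fin q, weight c ω' ^ β)
          ≤ L * (weight c w ^ β / κ) := by
            have := hZ k
            gcongr
        _ = L / κ * weight c w ^ β := by ring
        _ ≤ A * weight c w ^ β := by
            gcongr
            exact le_add_of_nonneg_left measureReal_nonneg
  obtain ⟨N, hN⟩ := hLE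
  -- `N + 1` in place of `N` makes the constant positive without a case distinction.
  refine ⟨m, (N + 1) * (A * ρ⁻¹ ^ u), hfin, by positivity, hmF, ?_, fun x hx r hr hr1 => ?_⟩
  · intro h0
    have hw := Real.rpow_pos_of_pos (weight_pos hcrit.pos fun _ : Fin 1 => (0 : Fin q)) β
    have hZ1 := hκ.trans_le (hZ 1)
    have h1 := (hm 1 le_rfl fun _ => 0).1
    have h2 : m Set.univ = 0 := by
      rw [← Set.union_compl_self (limitSet Δ)]
      exact measure_union_null h0 hmF
    rw [measure_mono_null (Set.subset_univ _) h2, nonpos_iff_eq_zero, ENNReal.ofReal_eq_zero] at h1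
    exact absurd h1 (not_le.2 (by positivity))
  have hcard := hN x hx r hr hr1
  have hfinite : (moranCoverAt Δ c x r).Finite :=
    Set.encard_lt_top_iff.1 (hcard.trans (ENat.natCast_lt_top N))
  have hcard' : (hfinite.toFinset.card : ℝ) ≤ N + 1 := by
    rw [hfinite.encard_eq_coe_toFinset_card, Nat.cast_lt] at hcard
    exact_mod_cast hcard.le.trans (Nat.le_succ N)
  have hsub : ball x r ⊆ (limitSet Δ)ᶜ ∪ ⋃ w ∈ hfinite.toFinset, Δ w.1 w.2 := by
    intro y hy
    by_cases hyF : y ∈ limitSet Δ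
    · obtain ⟨ω, hω⟩ := exists_coding hΔ hyF
      obtain ⟨k, hk⟩ := exists_isMoranWord_coding hb hcrit.pos ω hr hr1
      refine .inr (Set.mem_iUnion₂.2 ⟨⟨k, fun j => ω j⟩, ?_, hω k⟩)
      rw [Set.Finite.mem_toFinset]
      exact ⟨hk, y, ⟨hω k, hyF⟩, hy⟩
    · exact .inl hyF
  have hterm : ∀ w ∈ hfinite.toFinset,
      m (Δ w.1 w.2) ≤ ENNReal.ofReal (A * (ρ⁻¹ ^ u * r ^ u)) := by
    intro w hw
    rw [Set.Finite.mem_toFinset] at hw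
    obtain ⟨-, i, hi⟩ := hw.1.1
    have hwpos := weight_pos hcrit.pos w.2
    refine (hcyl w.1 w.2).trans (ENNReal.ofReal_le_ofReal ?_)
    refine mul_le_mul_of_nonneg_left ?_ hA.le
    rw [weight_snoc] at hi
    have h1 : weight c w.2 ^ (1 + η) ≤ ρ⁻¹ * r := by
      rw [inv_mul_eq_div, le_div_iff₀' hρ]
      exact (hext _ _ i).trans hi
    rw [← hηβ, Real.rpow_mul hwpos.le, ← Real.mul_rpow (by positivity) hr.le]
    exact Real.rpow_le_rpow (by positivity) h1 hu0.le
  calc m (ball x r) ≤ m (limitSet Δ)ᶜ + m (⋃ w ∈ hfinite.toFinset, Δ w.1 w.2) :=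
        (measure_mono hsub).trans (measure_union_le _ _)
    _ ≤ ∑ w ∈ hfinite.toFinset, m (Δ w.1 w.2) := by
        rw [hmF, zero_add]
        exact measure_biUnion_finset_le _ _
    _ ≤ hfinite.toFinset.card • ENNReal.ofReal (A * (ρ⁻¹ ^ u * r ^ u)) :=
        Finset.sum_le_card_nsmul _ _ _ hterm
    _ = ENNReal.ofReal (hfinite.toFinset.card * (A * (ρ⁻¹ ^ u * r ^ u))) := by
        rw [nsmul_eq_mul, ENNReal.ofReal_mul (Nat.cast_nonneg _), ENNReal.ofReal_natCast]
    _ ≤ ENNReal.ofReal ((N + 1) * (A * ρ⁻¹ ^ u) * r ^ u) := by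
        refine ENNReal.ofReal_le_ofReal ?_
        rw [mul_assoc ((N : ℝ) + 1), mul_assoc A]
        gcongr

end Gibbs

/-! ### The dimensions of the limit set -/

section Dimension

variable {q : ℕ} [NeZero q] {E : Type*} [NormedAddCommGroup E] [NormedSpace ℝ E]
  [MeasurableSpace E] [BorelSpace E] {Δ : ∀ k : ℕ, (Fin k → Fin q) → Set E}
  {c : ℕ → Fin q → ℝ} {s : ℝ}

/-- For a fixed sequence of contraction vectors with critical exponent `s`, all dimensions of the
limit set are `s`. -/
theorem dim_limitSet_eq (hΔ : IsMoranConstruction Δ) (hcrit : IsCritical c s) (hs : 0 ≤ s)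
    (hb : IsBasic c) (hU : IsUpperEstimating Δ c) (hLE : IsLowerEstimating Δ c)
    (hG : HasGibbsLikeMeasures Δ c) :
    dimH (limitSet Δ) = ENNReal.ofReal s ∧ dimP (limitSet Δ) = ENNReal.ofReal s ∧
      upperBoxDim (limitSet Δ) = (s : EReal) := by
  have hball : ∀ u : ℝ, s < u → ∃ (m : Measure E) (κ : ℝ), IsFiniteMeasure m ∧ 0 < κ ∧
      ∀ x ∈ limitSet Δ, ∀ r : ℝ, 0 < r → r < 1 →
        ENNReal.ofReal (κ * r ^ u) ≤ m (closedBall x r) := fun u hu =>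
    exists_measure_le_closedBall hΔ hcrit hs hb hU hG hu
  have hdimH : ∀ u : ℝ, 0 < u → u < s → ENNReal.ofReal u ≤ dimH (limitSet Δ) := by
    intro u hu0 hu
    obtain ⟨m, K, -, hK, hmF, hm, h⟩ := exists_measure_ball_le hΔ hcrit hb hLE hG hu0 hu
    exact le_dimH_of_measure_ball_le hK hu0 h hmF hm
  have hlt₁ : ∀ u : ℝ≥0, ENNReal.ofReal s < u → s < u := fun u h => by
    rwa [← ENNReal.ofReal_coe_nnreal, ENNReal.ofReal_lt_ofReal_iff_of_nonneg hs] at h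
  have hlt₂ : ∀ u : ℝ≥0, u < ENNReal.ofReal s → (u : ℝ) < s := fun u h => by
    rwa [← ENNReal.ofReal_coe_nnreal, ENNReal.ofReal_lt_ofReal_iff_of_nonneg u.coe_nonneg] at h
  refine ⟨le_antisymm ?_ ?_, le_antisymm ?_ ?_, le_antisymm ?_ ?_⟩
  · refine le_of_forall_gt_imp_ge_of_dense fun a ha => ?_
    obtain ⟨u, hu, hua⟩ := ENNReal.lt_iff_exists_nnreal_btwn.1 ha
    obtain ⟨m, κ, hm, hκ, h⟩ := hball u (hlt₁ u hu)
    have := dimH_le_of_le_measure_closedBall hκ u.coe_nonneg h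
    rw [ENNReal.ofReal_coe_nnreal] at this
    exact this.trans hua.le
  · refine ENNReal.le_of_forall_nnreal_lt fun u hu => ?_
    rcases eq_or_ne u 0 with rfl | hu0
    · simp
    rw [← ENNReal.ofReal_coe_nnreal]
    exact hdimH u (by positivity) (hlt₂ u hu)
  · refine iSup₂_le fun v hv => ?_
    by_contra hlt
    rw [not_le] at hlt
    obtain ⟨m, κ, hm, hκ, h⟩ := hball v (hlt₁ v hlt)
    exact packingMeasure_ne_top_of_le_measure_closedBall hκ v.coe_nonneg h hv
  · refine ENNReal.le_of_forall_nnreal_lt fun v hv => ?_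
    have hvs : (v : ℝ) < s := hlt₂ v hv
    have hv0 : (0 : ℝ) ≤ v := v.coe_nonneg
    set u := ((v : ℝ) + s) / 2
    have hu0 : 0 < u := by simp only [u]; linarith
    have hus : u < s := by simp only [u]; linarith
    have hvu : (v : ℝ) < u := by simp only [u]; linarith
    -- In the zero-dimensional space balls have diameter `0`, but there `s` cannot be positive.
    have : Nontrivial E := by
      by_contra hE
      rw [not_nontrivial_iff_subsingleton] at hE
      have := hdimH u hu0 hus
      rw [dimH_subsingleton (Set.subsingleton_of_subsingleton), nonpos_iff_eq_zero,
        ENNReal.ofReal_eq_zero] at this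
      linarith
    have hX : ∀ (x : E) (r : ℝ), 0 ≤ r → ENNReal.ofReal r ≤ ediam (closedBall x r) := by
      intro x r hr
      have h1 : diam (closedBall x r) = 2 * r := diam_closedBall_eq x hr
      refine le_trans (ENNReal.ofReal_le_ofReal ?_) ENNReal.ofReal_toReal_le
      change r ≤ diam (closedBall x r)
      linarith
    obtain ⟨m, K, -, hK, -, hm, h⟩ := exists_measure_ball_le hΔ hcrit hb hLE hG hu0 hus
    exact le_iSup₂_of_le v (packingMeasure_eq_top hX hK hv0 hvu h hm) le_rfl
  · refine EReal.le_of_forall_lt_iff_le.1 fun w hw => ?_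
    rw [EReal.coe_lt_coe_iff] at hw
    obtain ⟨m, κ, hm, hκ, h⟩ := hball ((s + w) / 2) (by linarith)
    refine upperBoxDim_le_of_externalCoveringNumber_le (u := (s + w) / 2)
      (K := m.real Set.univ / κ * 2 ^ ((s + w) / 2)) (by linarith) ?_
    filter_upwards [Ioo_mem_nhdsGT (one_pos : (0 : ℝ≥0) < 1)] with ε hε
    exact externalCoveringNumber_le_of_le_measure_closedBall hκ h hε.1 hε.2
  · refine EReal.ge_of_forall_gt_iff_ge.1 fun w hw => ?_
    rw [EReal.coe_lt_coe_iff] at hw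
    rcases le_or_gt w 0 with hw0 | hw0
    · exact (EReal.coe_le_coe_iff.2 hw0).trans (upperBoxDim_nonneg (limitSet_nonempty hΔ))
    obtain ⟨m, K, hfin, hK, -, hm, h⟩ := exists_measure_ball_le hΔ hcrit hb hLE hG
      (u := (w + s) / 2) (by linarith) (by linarith)
    refine le_upperBoxDim_of_le_externalCoveringNumber (u := (w + s) / 2)
      (K := m.real (limitSet Δ) / (K * 3 ^ ((w + s) / 2))) ?_ (by linarith) ?_
    · exact div_pos (ENNReal.toReal_pos hm (measure_ne_top _ _)) (by positivity)
    · have h3 : (0 : ℝ≥0) < 1 / 3 := by positivity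
      filter_upwards [Ioo_mem_nhdsGT h3] with ε hε
      have : (ε : ℝ) < (1 / 3 : ℝ≥0) := hε.2
      push_cast at this
      exact le_externalCoveringNumber_of_measure_ball_le hK h hε.1 this

end Dimension

end Moran

theorem mainTheorem4 {M : Type*} [MetricSpace M] [CompactSpace M] [MeasurableSpace M]
    [BorelSpace M] (q d : ℕ) (hq : 1 ≤ q)
    (T : Fin q → M → M) (μ : Fin q → Measure M) [∀ i, IsProbabilityMeasure (μ i)]
    (hmix : ∀ i, Moran.IsMixing (T i) (μ i))
    (φ : Fin q → M → ℝ)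
    (hφ : ∀ i y, 0 ≤ φ i y ∧ φ i y < 1)
    (hφpos : ∀ i, ∀ᵐ y ∂(μ i), 0 < φ i y)
    (hφ_holder : ∀ i, ∃ C α : ℝ≥0, 0 < α ∧ HolderWith C α (φ i))
    (hφlog : ∀ i, Integrable (fun y => Real.log (φ i y)) (μ i))
    (hφneg : ∀ i, ∫ y, Real.log (φ i y) ∂(μ i) < 0) :
    ∃ s : ℝ, 0 ≤ s ∧
      Integrable (Moran.logSum φ s) (Measure.pi μ) ∧
      ∫ x, Moran.logSum φ s x ∂(Measure.pi μ) = 0 ∧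
      (∀ t : ℝ, ∫ x, Moran.logSum φ t x ∂(Measure.pi μ) = 0 → t = s) ∧
      ∀ᵐ x ∂(Measure.pi μ),
        ∀ Δ : ∀ k : ℕ, (Fin k → Fin q) → Set (EuclideanSpace ℝ (Fin d)),
          Moran.IsMoranConstruction Δ →
          Moran.IsBasic (Moran.stochasticVector T φ x) →
          Moran.IsUpperEstimating Δ (Moran.stochasticVector T φ x) →
          Moran.IsLowerEstimating Δ (Moran.stochasticVector T φ x) →
          Moran.HasGibbsLikeMeasures Δ (Moran.stochasticVector T φ x) →
            dimH (Moran.limitSet Δ) = ENNReal.ofReal s ∧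
            Moran.dimP (Moran.limitSet Δ) = ENNReal.ofReal s ∧
            Moran.upperBoxDim (Moran.limitSet Δ) = (s : EReal) := by
  have : NeZero q := ⟨by omega⟩
  have hφm : ∀ i, Measurable (φ i) := fun i => by
    obtain ⟨C, α, hα, h⟩ := hφ_holder i
    exact (h.continuous hα).measurable
  obtain ⟨s, hs, hs0, hleft, hright⟩ := Moran.exists_integral_logSum_eq_zero hφm
    (fun i y => (hφ i y).2) hφpos hφlog
  refine ⟨s, hs, Moran.integrable_logSum hφm hφpos hφlog s, hs0, fun t ht => ?_, ?_⟩
  · rcases lt_trichotomy t s with h | h | h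
    · exact absurd ht (hleft t h).ne'
    · exact h
    · exact absurd ht (hright t h).ne
  · filter_upwards [Moran.ae_isCritical_stochasticVector hmix hφm hφ hφpos hφlog hleft hright]
      with x hx Δ hΔ hb hU hL hG
    exact Moran.dim_limitSet_eq hΔ hx hs hb hU hL hG
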